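/- Let $N\ge 0$ and $\beta\ge 0$ be integers. A partition is a sequence $\lambda=(\lambda_1\ge\cdots\ge\lambda_N\ge 0)$ of integers, $|\lambda|=\sum_i\lambda_i$, and $m_\lambda\in\mathbb C[x]=\mathbb C[x_1,\dots,x_N]$ is the monomial symmetric function. Write $\mu<\lambda$ if $\mu\ne\lambda$ and $\mu_1+\cdots+\mu_k\le\lambda_1+\cdots+\lambda_k$ for all $1\le k\le N$ (weights may differ), and $\mu<_{\mathrm D}\lambda$ if moreover $|\mu|=|\lambda|$. Let $s_{jk}$ exchange $x_j$ and $x_k$ and define operators on $\mathbb C[x]$ by $$D_j=\frac{\partial}{\partial x_j}+\beta\sum_{k\ne j}\frac{1-s_{jk}}{x_j-x_k},\qquad \hat D_j=x_jD_j+\beta\sum_{k<j}s_{jk},\qquad \tilde a_j^\dagger=\frac1{\sqrt2}\,(2x_j-D_j).$$ The Jack polynomial $J_\lambda^{(\beta)}$ is the polynomial of the form $m_\lambda+\sum_{\mu<_{\mathrm D}\lambda}u_{\lambda\mu}m_\mu$ that is an eigenfunction of $\sum_{j=1}^N\bigl(\hat D_j-\tfrac\beta2(N-1)\bigr)^2$.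 The multivariable Hermite polynomial $H_\lambda^{(\beta)}$ is the polynomial of the form $m_\lambda+\sum_{\mu<\lambda}u'_{\lambda\mu}m_\mu$ that satisfies $\langle H_\lambda^{(\beta)},m_\mu\rangle=0$ for every partition $\mu<\lambda$, where $$\langle f,g\rangle=\int_{\mathbb R^N}f(x)g(x)\prod_{j<k}|x_j-x_k|^{2\beta}\prod_{j=1}^Ne^{-x_j^2}\,dx_1\cdots dx_N .$$ The operators $\tilde a^\dagger_1,\dots,\tilde a^\dagger_N$ commute pairwise, so that $f(\tilde a^\dagger)=f(\tilde a_1^\dagger,\dots,\tilde a_N^\dagger)$ is well defined for $f\in\mathbb C[x]$; let $\sigma^A$ be the linear operator on $\mathbb C[x]$ with $\sigma^A(f)=f(\tilde a^\dagger)\cdot 1$. For every partition $\lambda$ the polynomials $J_\lambda^{(\beta)}$ and $H_\lambda^{(\beta)}$ exist and are unique, and $$H^{(\beta)}_\lambda=2^{-|\lambda|/2}\,\sigma^A\bigl(J^{(\beta)}_\lambda\bigr)=2^{-|\lambda|/2}\,J^{(\beta)}_\lambda(\tilde a^\dagger)\cdot 1 .$$ -/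

import Mathlib

namespace CalogeroHermite

open MvPolynomial

noncomputable section

/-- The polynomial ring `ℂ[x_1, …, x_N]`. -/
abbrev Poly (N : ℕ) : Type := MvPolynomial (Fin N) ℂ

/-! ### Dunkl and Cherednik operators -/

/-- The transposition `s_{jk}`, acting on polynomials by exchanging `x_j` and `x_k`. -/
def exch {N : ℕ} (j k : Fin N) : Module.End ℂ (Poly N) :=
  (rename (Equiv.swap j k) : Poly N →ₐ[ℂ] Poly N).toLinearMap

theorem X_sub_X_dvd_sub_exch {N : ℕ} (j k : Fin N) (f : Poly N) :
    (X j - X k : Poly N) ∣ f - exch j k f := by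
  induction f using MvPolynomial.induction_on with
  | C a => simp [exch]
  | add p q hp hq =>
    have h : p + q - exch j k (p + q) = (p - exch j k p) + (q - exch j k q) := by
      rw [map_add]; ring
    rw [h]
    exact dvd_add hp hq
  | mul_X p i hp =>
    have h : p * X i - exch j k (p * X i)
        = (p - exch j k p) * X i + exch j k p * (X i - X (Equiv.swap j k i)) := by
      simp only [exch, AlgHom.toLinearMap_apply, map_mul, rename_X]; ring
    rw [h]
    refine dvd_add (Dvd.dvd.mul_right hp _) (Dvd.dvd.mul_left ?_ _)
    rcases eq_or_ne i j with rfl | hj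
    · rw [Equiv.swap_apply_left]
    · rcases eq_or_ne i k with rfl | hk
      · rw [Equiv.swap_apply_right, ← neg_sub (X j : Poly N) (X i)]
        exact (dvd_neg (α := Poly N)).mpr (dvd_refl _)
      · rw [Equiv.swap_apply_of_ne_of_ne hj hk, sub_self]
        exact dvd_zero _

/-- The quotient `(f - s_{jk} f) / (x_j - x_k)` for `j ≠ k` (and `0` for `j = k`). -/
def divDiffFun {N : ℕ} (j k : Fin N) (f : Poly N) : Poly N :=
  if j = k then 0 else (X_sub_X_dvd_sub_exch j k f).choose

theorem X_sub_X_mul_divDiffFun {N : ℕ} {j k : Fin N} (h : j ≠ k) (f : Poly N) :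
    (X j - X k) * divDiffFun j k f = f - exch j k f := by
  rw [divDiffFun, if_neg h]
  exact (X_sub_X_dvd_sub_exch j k f).choose_spec.symm

theorem X_sub_X_ne_zero {N : ℕ} {j k : Fin N} (h : j ≠ k) : (X j - X k : Poly N) ≠ 0 :=
  sub_ne_zero.mpr fun e => h (X_injective e)

/-- The operator `(1 - s_{jk}) / (x_j - x_k)` on polynomials, for `j ≠ k`. -/
def divDiff {N : ℕ} (j k : Fin N) : Module.End ℂ (Poly N) where
  toFun := divDiffFun j k
  map_add' f g := by
    by_cases h : j = k
    · simp [divDiffFun, h]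
    · apply mul_left_cancel₀ (X_sub_X_ne_zero h)
      rw [mul_add, X_sub_X_mul_divDiffFun h, X_sub_X_mul_divDiffFun h,
        X_sub_X_mul_divDiffFun h, map_add]
      ring
  map_smul' c f := by
    by_cases h : j = k
    · simp [divDiffFun, h]
    · apply mul_left_cancel₀ (X_sub_X_ne_zero h)
      rw [RingHom.id_apply, mul_smul_comm, X_sub_X_mul_divDiffFun h,
        X_sub_X_mul_divDiffFun h, map_smul, smul_sub]

theorem X_sub_X_mul_divDiff {N : ℕ} {j k : Fin N} (h : j ≠ k) (f : Poly N) :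
    (X j - X k) * divDiff j k f = f - exch j k f :=
  X_sub_X_mul_divDiffFun h f

/-- Multiplication by the coordinate `x_j`. -/
def mulX {N : ℕ} (j : Fin N) : Module.End ℂ (Poly N) :=
  LinearMap.mulLeft ℂ (X j : Poly N)

/-- The Dunkl operator `D_j = ∂/∂x_j + β ∑_{k ≠ j} (1 - s_{jk}) / (x_j - x_k)`. -/
def dunkl {N : ℕ} (β : ℕ) (j : Fin N) : Module.End ℂ (Poly N) :=
  (pderiv j : Derivation ℂ (Poly N) (Poly N)).toLinearMap
    + (β : ℂ) • ∑ k ∈ Finset.univ.erase j, divDiff j k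

/-- The Cherednik operator `D̂_j = x_j D_j + β ∑_{k < j} s_{jk}`. -/
def cherednik {N : ℕ} (β : ℕ) (j : Fin N) : Module.End ℂ (Poly N) :=
  mulX j * dunkl β j + (β : ℂ) • ∑ k ∈ Finset.Iio j, exch j k

/-- The gauge-transformed Sutherland Hamiltonian `∑_j (D̂_j - (β/2)(N-1))²`; it is only applied
to symmetric polynomials. -/
def sutherland {N : ℕ} (β : ℕ) : Module.End ℂ (Poly N) :=
  ∑ j : Fin N, (cherednik β j - ((β : ℂ) / 2 * ((N : ℂ) - 1)) • 1) ^ 2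

/-! ### Partitions, monomial symmetric functions, dominance

A partition with at most `N` parts is an antitone function `lam : Fin N → ℕ`. -/

/-- The weight `|λ|`. -/
def wt {N : ℕ} (lam : Fin N → ℕ) : ℕ := ∑ i, lam i

/-- The monomial symmetric function `m_λ` in `N` variables. -/
def mono {N : ℕ} (lam : Fin N → ℕ) : Poly N :=
  msymm (Fin N) ℂ (Nat.Partition.ofMultiset (Finset.univ.val.map lam))

/-- Strict dominance between partitions of arbitrary weights: `μ ≠ λ` and
`μ_1 + ⋯ + μ_k ≤ λ_1 + ⋯ + λ_k` for `k = 1, …, N`. -/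
def DomLT {N : ℕ} (mu lam : Fin N → ℕ) : Prop :=
  mu ≠ lam ∧ ∀ k : Fin N, ∑ i ∈ Finset.Iic k, mu i ≤ ∑ i ∈ Finset.Iic k, lam i

/-- Strict dominance between partitions of the same weight. -/
def DomLTSame {N : ℕ} (mu lam : Fin N → ℕ) : Prop :=
  wt mu = wt lam ∧ DomLT mu lam

/-- `P = m_λ + ∑_{μ < λ} u_μ m_μ` for some coefficients `u_μ`, the (finite) sum being over
partitions `μ` that are smaller than `λ` for the relation `lt`. -/
def IsMonicTriangular {N : ℕ} (lt : (Fin N → ℕ) → (Fin N → ℕ) → Prop) (lam : Fin N → ℕ)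
    (P : Poly N) : Prop :=
  P - mono lam ∈ Submodule.span ℂ {p : Poly N | ∃ mu, Antitone mu ∧ lt mu lam ∧ p = mono mu}

/-- `J` is the symmetric Jack polynomial `J_λ^{(β)}` in `N` variables. -/
def IsJack {N : ℕ} (β : ℕ) (lam : Fin N → ℕ) (J : Poly N) : Prop :=
  IsMonicTriangular DomLTSame lam J ∧ ∃ E : ℂ, sutherland β J = E • J

/-! ### Multivariable Hermite polynomials -/

/-- `φ(x) = ∏_{j<k} |x_j - x_k|^β ∏_j exp(-x_j²/2)`. -/
def groundState {N : ℕ} (β : ℕ) (x : Fin N → ℝ) : ℝ :=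
  (∏ j : Fin N, ∏ k ∈ Finset.Ioi j, |x j - x k| ^ β) * ∏ j : Fin N, Real.exp (-(x j) ^ 2 / 2)

/-- `⟨f, g⟩ = ∫ f(x) g(x) φ(x)² dx_1 ⋯ dx_N` over `ℝ^N` (bilinear). -/
def hermitePairing {N : ℕ} (β : ℕ) (f g : Poly N) : ℂ :=
  ∫ x : Fin N → ℝ, eval (fun i => (x i : ℂ)) f * eval (fun i => (x i : ℂ)) g
    * ((groundState β x ^ 2 : ℝ) : ℂ)

/-- `H` is the multivariable Hermite polynomial `H_λ^{(β)}` in `N` variables. -/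
def IsHermite {N : ℕ} (β : ℕ) (lam : Fin N → ℕ) (H : Poly N) : Prop :=
  IsMonicTriangular DomLT lam H ∧
    ∀ mu : Fin N → ℕ, Antitone mu → DomLT mu lam → hermitePairing β H (mono mu) = 0

/-! ### The intertwiner -/

/-- The gauge-transformed creation operator
`ã†_j = (1/√2) (-∂/∂x_j + 2 x_j - β ∑_{k ≠ j} (1 - s_{jk}) / (x_j - x_k))`. -/
def creation {N : ℕ} (β : ℕ) (j : Fin N) : Module.End ℂ (Poly N) :=
  ((1 / Real.sqrt 2 : ℝ) : ℂ) • ((2 : ℂ) • mulX j - dunkl β j)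

/-- The operator `f(T_1, …, T_N)` for a polynomial `f` and commuting operators `T_j`: linear in `f`
and sending `x_1^{n_1} ⋯ x_N^{n_N}` to `T_1^{n_1} ⋯ T_N^{n_N}`. -/
def opEval {N : ℕ} (T : Fin N → Module.End ℂ (Poly N)) : Poly N →ₗ[ℂ] Module.End ℂ (Poly N) :=
  (basisMonomials (Fin N) ℂ).constr ℂ fun n => (List.ofFn fun j => T j ^ n j).prod

/-- The intertwiner `σ f = f(ã†_1, …, ã†_N) · 1`, a linear operator on polynomials. -/
def sigmaA {N : ℕ} (β : ℕ) : Module.End ℂ (Poly N) where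
  toFun f := opEval (creation β) f 1
  map_add' f g := by simp
  map_smul' c f := by simp

end

end CalogeroHermite

namespace CalogeroHermite

open MvPolynomial

variable {N : ℕ}

/-! ### Dunkl operators -/

/-! The map σ = σ^A turns multiplication by x_j into ã†_j and, up to the factor √2, commutes with
the Dunkl operators (`dunkl_sigmaA`): the commutator [D_j, x_k] involves only the identity and
transpositions, and σ is permutation equivariant. Hence σ carries x_j D_j to the number operator
ã†_j ã_j with ã_j = D_j/√2 (`number_sigmaA`). On symmetric polynomials the Sutherland operator is ∑
(x_j D_j)² plus a constant (`sutherland_of_isSymmetric`), so σ(J_λ) is an eigenfunction of ∑ (ã†_j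
ã_j)², with eigenvalue `energy β lam`, and by Euler's identity of ∑ ã†_j ã_j, with eigenvalue |λ|.

Integration by parts against the weight (`gaussInt_dunkl`) makes ã_j the transpose of ã†_j, so both
sums are self-adjoint. If μ < λ, then either the weights differ or the energies do
(`energy_lt_energy`), so σ(J_μ) and σ(J_λ) are orthogonal.

Triangularity comes from a second description: in degree d, σ = 2^{d/2} exp(-L/4) with L = ∑ D_j²
(`sigmaA_of_isHomogeneous`). The corrections to the leading term have smaller degree, and they stay
dominated by λ because Dunkl operators only push exponents down (`Below`). So 2^{-|λ|/2} σ(J_λ) is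
monic triangular; the analogous polynomials for ν ≤ μ span m_μ, and orthogonality to every m_μ with
μ < λ follows. These properties characterise H_λ, since the pairing is definite on polynomials with
real coefficients (`hermitePairing_conj_eq_zero`, `eq_zero_of_mem_span_mono`).

Jack polynomials exist because ∑ (x_j D_j)² is triangular on the m_μ with strictly increasing
diagonal entries (`exists_isJack`). Their uniqueness is inherited from that of H_λ, as σ is
injective on homogeneous polynomials. -/

theorem exch_apply (j k : Fin N) (f : Poly N) : exch j k f = rename (Equiv.swap j k) f := rfl

theorem exch_comm (j k : Fin N) : exch j k = exch k j := by
  simp only [exch, Equiv.swap_comm j k]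

theorem exch_exch (j k : Fin N) (f : Poly N) : exch j k (exch j k f) = f := by
  simp only [exch_apply, rename_rename, ← Equiv.coe_trans]
  simp

theorem exch_mul (j k : Fin N) (f g : Poly N) : exch j k (f * g) = exch j k f * exch j k g := by
  simp only [exch_apply, map_mul]

theorem exch_X (j k i : Fin N) : exch j k (X i) = X (Equiv.swap j k i) := by
  simp [exch_apply]

theorem divDiff_self (j : Fin N) (f : Poly N) : divDiff j j f = 0 := by
  simp [divDiff, divDiffFun]

theorem rename_exch (π : Equiv.Perm (Fin N)) (j k : Fin N) (f : Poly N) :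
    rename π (exch j k f) = exch (π j) (π k) (rename π f) := by
  simp only [exch_apply, rename_rename]
  congr 1
  ext i
  simp [Equiv.swap_apply_def]
  split_ifs <;> simp_all

theorem rename_divDiff (π : Equiv.Perm (Fin N)) (j k : Fin N) (f : Poly N) :
    rename π (divDiff j k f) = divDiff (π j) (π k) (rename π f) := by
  by_cases h : j = k
  · subst h; simp [divDiff_self]
  · have h' : π j ≠ π k := fun e => h (π.injective e)
    apply mul_left_cancel₀ (X_sub_X_ne_zero h')
    rw [X_sub_X_mul_divDiff h', ← rename_exch, ← map_sub, ← X_sub_X_mul_divDiff h, map_mul,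
      map_sub, rename_X, rename_X]

theorem divDiff_comm (j k : Fin N) (f : Poly N) : divDiff k j f = -divDiff j k f := by
  by_cases h : j = k
  · subst h; simp [divDiff_self]
  · apply mul_left_cancel₀ (X_sub_X_ne_zero h)
    have h1 := X_sub_X_mul_divDiff h f
    have h2 := X_sub_X_mul_divDiff (Ne.symm h) f
    rw [exch_comm] at h2
    linear_combination h1 - h2

theorem divDiff_exch (j k : Fin N) (f : Poly N) : divDiff j k (exch j k f) = -divDiff j k f := by
  by_cases h : j = k
  · subst h; simp [divDiff_self]
  · apply mul_left_cancel₀ (X_sub_X_ne_zero h)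
    have h1 := X_sub_X_mul_divDiff h f
    have h2 := X_sub_X_mul_divDiff h (exch j k f)
    rw [exch_exch] at h2
    linear_combination h2 + h1

theorem divDiff_mul {j k : Fin N} (h : j ≠ k) (f g : Poly N) :
    divDiff j k (f * g) = f * divDiff j k g + divDiff j k f * exch j k g := by
  apply mul_left_cancel₀ (X_sub_X_ne_zero h)
  have h1 := X_sub_X_mul_divDiff h f
  have h2 := X_sub_X_mul_divDiff h g
  have h3 := X_sub_X_mul_divDiff h (f * g)
  rw [exch_mul] at h3
  linear_combination h3 - f * h2 - h1 * exch j k g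

theorem divDiff_X_left {j k : Fin N} (h : j ≠ k) : divDiff j k (X j : Poly N) = 1 := by
  apply mul_left_cancel₀ (X_sub_X_ne_zero h)
  rw [X_sub_X_mul_divDiff h, exch_X, Equiv.swap_apply_left, mul_one]

theorem divDiff_X_right {j k : Fin N} (h : j ≠ k) : divDiff j k (X k : Poly N) = -1 := by
  rw [divDiff_comm k j, divDiff_X_left h.symm]

theorem divDiff_X_of_ne {j k i : Fin N} (h : j ≠ k) (hj : i ≠ j) (hk : i ≠ k) :
    divDiff j k (X i : Poly N) = 0 := by
  apply mul_left_cancel₀ (X_sub_X_ne_zero h)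
  rw [X_sub_X_mul_divDiff h, exch_X, Equiv.swap_apply_of_ne_of_ne hj hk, mul_zero, sub_self]

theorem divDiff_of_exch_eq {j k : Fin N} {f : Poly N} (hf : exch j k f = f) :
    divDiff j k f = 0 := by
  by_cases h : j = k
  · subst h; simp [divDiff_self]
  · apply mul_left_cancel₀ (X_sub_X_ne_zero h)
    rw [X_sub_X_mul_divDiff h, hf, sub_self, mul_zero]

theorem dunkl_apply (β : ℕ) (j : Fin N) (f : Poly N) :
    dunkl β j f = pderiv j f + (β : ℂ) • ∑ k ∈ Finset.univ.erase j, divDiff j k f := by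
  simp [dunkl]

theorem dunkl_one (β : ℕ) (j : Fin N) : dunkl β j (1 : Poly N) = 0 := by
  rw [dunkl_apply, Finset.sum_eq_zero fun k _ => divDiff_of_exch_eq (by simp [exch_apply])]
  simp

theorem rename_dunkl (β : ℕ) (π : Equiv.Perm (Fin N)) (j : Fin N) (f : Poly N) :
    rename π (dunkl β j f) = dunkl β (π j) (rename π f) := by
  rw [dunkl_apply, dunkl_apply, map_add, map_smul, map_sum, pderiv_rename π.injective]
  congr 2
  refine Finset.sum_equiv π (by simp) fun k _ => rename_divDiff π j k f

theorem exch_dunkl_left (β : ℕ) (i j : Fin N) (f : Poly N) :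
    exch i j (dunkl β i f) = dunkl β j (exch i j f) := by
  rw [exch_apply, rename_dunkl, Equiv.swap_apply_left]; rfl

theorem exch_dunkl_right (β : ℕ) (i j : Fin N) (f : Poly N) :
    exch i j (dunkl β j f) = dunkl β i (exch i j f) := by
  rw [exch_apply, rename_dunkl, Equiv.swap_apply_right]; rfl

theorem exch_dunkl_of_ne (β : ℕ) {i j k : Fin N} (hi : k ≠ i) (hj : k ≠ j) (f : Poly N) :
    exch i j (dunkl β k f) = dunkl β k (exch i j f) := by
  rw [exch_apply, rename_dunkl, Equiv.swap_apply_of_ne_of_ne hi hj]; rfl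

/-- The operator `[D_j, x_k]`. -/
noncomputable def dunklComm (β : ℕ) (j k : Fin N) : Module.End ℂ (Poly N) :=
  if j = k then 1 + (β : ℂ) • ∑ l ∈ Finset.univ.erase j, exch j l else -(β : ℂ) • exch j k

theorem dunklComm_self (β : ℕ) (j : Fin N) (f : Poly N) :
    dunklComm β j j f = f + (β : ℂ) • ∑ l ∈ Finset.univ.erase j, exch j l f := by
  simp [dunklComm]

theorem dunklComm_of_ne (β : ℕ) {j k : Fin N} (h : j ≠ k) (f : Poly N) :
    dunklComm β j k f = -((β : ℂ) • exch j k f) := by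
  simp [dunklComm, h]

/-- Leibniz for the derivative plus the twisted Leibniz rule for divided differences; the divided
difference of x_k along (j, l) is 1, -1 or 0 according to whether k is j, l or neither. -/
theorem dunkl_X_mul (β : ℕ) (j k : Fin N) (f : Poly N) :
    dunkl β j (X k * f) = X k * dunkl β j f + dunklComm β j k f := by
  rw [dunkl_apply, dunkl_apply, Derivation.leibniz]
  have key : ∀ l ∈ Finset.univ.erase j, divDiff j l (X k * f)
      = X k * divDiff j l f + divDiff j l (X k) * exch j l f := fun l hl =>
    divDiff_mul (Finset.ne_of_mem_erase hl).symm _ _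
  rw [Finset.sum_congr rfl key, Finset.sum_add_distrib, ← Finset.mul_sum, smul_add, mul_add,
    mul_smul_comm]
  by_cases h : j = k
  · subst h
    have hX : ∀ l ∈ Finset.univ.erase j, divDiff j l (X j) * exch j l f = exch j l f :=
      fun l hl => by rw [divDiff_X_left (Finset.ne_of_mem_erase hl).symm, one_mul]
    rw [dunklComm_self, Finset.sum_congr rfl hX]
    simp only [pderiv_X_self, smul_eq_mul]
    ring
  · have hX : ∑ l ∈ Finset.univ.erase j, divDiff j l (X k) * exch j l f = -exch j k f := by
      rw [Finset.sum_eq_single k]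
      · rw [divDiff_X_right h, neg_one_mul]
      · intro l hl hlk
        rw [divDiff_X_of_ne (Finset.ne_of_mem_erase hl).symm (Ne.symm h) hlk.symm, zero_mul]
      · intro hk
        exact absurd (Finset.mem_erase.mpr ⟨Ne.symm h, Finset.mem_univ k⟩) hk
    rw [dunklComm_of_ne β h, hX, pderiv_X_of_ne (Ne.symm h)]
    simp only [smul_eq_mul, smul_neg]
    ring

/-- Induction principle: two linear maps that agree at `1` and whose agreement is preserved by
multiplication with the coordinates are equal. -/
theorem poly_induction {p : Poly N → Prop}
    (add : ∀ f g, p f → p g → p (f + g)) (smul : ∀ (c : ℂ) f, p f → p (c • f)) (one : p 1)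
    (X_mul : ∀ (j : Fin N) f, p f → p (X j * f)) (f : Poly N) : p f := by
  induction f using MvPolynomial.induction_on with
  | C a =>
    have := smul a 1 one
    rwa [smul_eq_C_mul, mul_one] at this
  | add f g hf hg => exact add f g hf hg
  | mul_X f j hf =>
    rw [mul_comm]; exact X_mul j f hf

/-- The identity [D_i, [D_j, x_k]] = [D_j, [D_i, x_k]], which is what propagates [D_i, D_j] = 0
through multiplication by x_k. It follows from equivariance: transpositions permute the indices of
the D's, and only the transposition (i j) leaves something to match when k is i or j. -/
theorem dunkl_dunklComm (β : ℕ) {i j : Fin N} (hij : i ≠ j) (k : Fin N) (f : Poly N) :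
    dunkl β i (dunklComm β j k f) - dunklComm β j k (dunkl β i f)
      = dunkl β j (dunklComm β i k f) - dunklComm β i k (dunkl β j f) := by
  have main : ∀ {i j : Fin N}, i ≠ j → ∀ f : Poly N,
      dunkl β i (dunklComm β j i f) - dunklComm β j i (dunkl β i f)
        = dunkl β j (dunklComm β i i f) - dunklComm β i i (dunkl β j f) := by
    intro i j hij f
    rw [dunklComm_of_ne β hij.symm, dunklComm_of_ne β hij.symm, dunklComm_self, dunklComm_self]
    simp only [map_add, map_neg, map_smul, map_sum]
    have hj : j ∈ Finset.univ.erase i := Finset.mem_erase.mpr ⟨hij.symm, Finset.mem_univ j⟩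
    rw [← Finset.add_sum_erase _ _ hj, ← Finset.add_sum_erase _ _ hj]
    have rest : ∀ l ∈ (Finset.univ.erase i).erase j,
        exch i l (dunkl β j f) = dunkl β j (exch i l f) := fun l hl =>
      exch_dunkl_of_ne β hij.symm (Finset.ne_of_mem_erase hl).symm f
    rw [Finset.sum_congr rfl rest, exch_comm j i, exch_dunkl_left, exch_dunkl_right]
    simp only [smul_add]
    ring
  by_cases hi : i = k
  · subst hi; exact main hij f
  by_cases hj : j = k
  · subst hj; exact (main hij.symm f).symm
  rw [dunklComm_of_ne β hi, dunklComm_of_ne β hi, dunklComm_of_ne β hj, dunklComm_of_ne β hj,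
    exch_dunkl_of_ne β hij hi, exch_dunkl_of_ne β hij.symm hj]
  simp

theorem dunkl_comm (β : ℕ) (i j : Fin N) (f : Poly N) :
    dunkl β i (dunkl β j f) = dunkl β j (dunkl β i f) := by
  by_cases hij : i = j
  · subst hij; rfl
  induction f using poly_induction with
  | add f g hf hg => simp only [map_add, hf, hg]
  | smul c f hf => simp only [map_smul, hf]
  | one => simp [dunkl_one]
  | X_mul k f hf =>
    simp only [dunkl_X_mul, map_add, hf]
    linear_combination dunkl_dunklComm β hij k f

/-- The Dunkl Laplacian `∑_j D_j²`. -/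
noncomputable def laplace (β : ℕ) : Module.End ℂ (Poly N) := ∑ j : Fin N, dunkl β j * dunkl β j

theorem laplace_apply (β : ℕ) (f : Poly N) :
    laplace β f = ∑ j : Fin N, dunkl β j (dunkl β j f) := by
  simp [laplace]

theorem dunkl_laplace (β : ℕ) (j : Fin N) (f : Poly N) :
    dunkl β j (laplace β f) = laplace β (dunkl β j f) := by
  simp only [laplace_apply, map_sum, dunkl_comm β j]

/-- As for the ordinary Laplacian: the transposition terms of [D_i², x_j] with i ≠ j cancel those of
[D_j², x_j], because s_ij D_i = D_j s_ij. -/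
theorem laplace_X_mul (β : ℕ) (j : Fin N) (f : Poly N) :
    laplace β (X j * f) = X j * laplace β f + (2 : ℂ) • dunkl β j f := by
  have key : ∀ i : Fin N, dunkl β i (dunkl β i (X j * f)) = X j * dunkl β i (dunkl β i f)
      + (dunklComm β i j (dunkl β i f) + dunkl β i (dunklComm β i j f)) := fun i => by
    simp only [dunkl_X_mul, map_add]; ring
  rw [laplace_apply, laplace_apply, Finset.sum_congr rfl fun i _ => key i, Finset.sum_add_distrib,
    ← Finset.mul_sum]
  congr 1
  rw [← Finset.add_sum_erase _ _ (Finset.mem_univ j), dunklComm_self, dunklComm_self]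
  have rest : ∀ i ∈ Finset.univ.erase j,
      dunklComm β i j (dunkl β i f) + dunkl β i (dunklComm β i j f)
        = -((β : ℂ) • (exch j i (dunkl β j f) + dunkl β j (exch j i f))) := fun i hi => by
    have hij := Finset.ne_of_mem_erase hi
    rw [dunklComm_of_ne β hij, dunklComm_of_ne β hij, exch_comm i j, exch_dunkl_right,
      exch_dunkl_left, map_neg, map_smul, smul_add]
    ring
  rw [Finset.sum_congr rfl rest]
  simp only [map_add, map_smul, map_sum, Finset.sum_neg_distrib, ← Finset.smul_sum,
    Finset.sum_add_distrib, smul_add, two_smul]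
  ring

/-! ### Creation operators and the intertwiner -/

/-- The scalar `√2`. -/
noncomputable def sqrtTwo : ℂ := (Real.sqrt 2 : ℝ)

theorem sqrtTwo_mul_self : sqrtTwo * sqrtTwo = 2 := by
  rw [sqrtTwo, ← Complex.ofReal_mul, Real.mul_self_sqrt (by norm_num)]; simp

theorem sqrtTwo_ne_zero : sqrtTwo ≠ 0 := fun h => by
  have := sqrtTwo_mul_self
  rw [h] at this; norm_num at this

theorem creation_apply (β : ℕ) (j : Fin N) (f : Poly N) :
    creation β j f = sqrtTwo⁻¹ • ((2 : ℂ) • (X j * f) - dunkl β j f) := by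
  simp [creation, sqrtTwo, mulX]

/-- For i ≠ j the cross terms contain [D_i, x_j] = -β s_ij, which is symmetric in i and j. -/
theorem creation_creation (β : ℕ) (i j : Fin N) (f : Poly N) :
    creation β i (creation β j f) = creation β j (creation β i f) := by
  by_cases hij : i = j
  · subst hij; rfl
  simp only [creation_apply, map_smul, map_sub, dunkl_X_mul, dunkl_comm β i j,
    dunklComm_of_ne β hij, dunklComm_of_ne β (Ne.symm hij), exch_comm j i]
  rw [mul_left_comm (X j)]
  module

theorem commute_creation (β : ℕ) (i j : Fin N) :
    Commute (creation (N := N) β i) (creation β j) :=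
  LinearMap.ext fun f => creation_creation β i j f

theorem prod_ofFn_mul_of_commute {M : Type*} [Monoid M] {n : ℕ} (a b : Fin n → M)
    (h : ∀ i j, Commute (a i) (b j)) :
    (List.ofFn fun i => a i * b i).prod = (List.ofFn a).prod * (List.ofFn b).prod := by
  induction n with
  | zero => simp
  | succ n ih =>
    rw [List.ofFn_succ, List.ofFn_succ, List.ofFn_succ, List.prod_cons, List.prod_cons,
      List.prod_cons, ih _ _ fun i j => h i.succ j.succ]
    have hc : Commute (List.ofFn fun i : Fin n => a i.succ).prod (b 0) := by
      refine Commute.list_prod_left _ _ fun x hx => ?_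
      obtain ⟨i, rfl⟩ := (List.mem_ofFn' _ _).mp hx
      exact h _ _
    simp only [mul_assoc, ← hc.left_comm]

theorem prod_ofFn_mulSingle {M : Type*} [Monoid M] {n : ℕ} (j : Fin n) (x : M) :
    (List.ofFn (Pi.mulSingle (M := fun _ => M) j x)).prod = x := by
  induction n with
  | zero => exact j.elim0
  | succ n ih =>
    rw [List.ofFn_succ, List.prod_cons]
    refine Fin.cases ?_ (fun i => ?_) j
    · rw [Pi.mulSingle_eq_same, List.prod_eq_one, mul_one]
      intro y hy
      obtain ⟨i, rfl⟩ := (List.mem_ofFn' _ _).mp hy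
      exact Pi.mulSingle_eq_of_ne (Fin.succ_ne_zero i) x
    · rw [Pi.mulSingle_eq_of_ne (Fin.succ_ne_zero i).symm, one_mul]
      conv_rhs => rw [← ih i]
      congr 2
      ext k
      simp [Pi.mulSingle_apply]

theorem opEval_monomial (T : Fin N → Module.End ℂ (Poly N)) (n : Fin N →₀ ℕ) :
    opEval T (monomial n 1) = (List.ofFn fun j => T j ^ n j).prod := by
  have := (basisMonomials (Fin N) ℂ).constr_basis ℂ
    (fun n => (List.ofFn fun j => T j ^ n j).prod) n
  rwa [coe_basisMonomials] at this

theorem opEval_X_mul {T : Fin N → Module.End ℂ (Poly N)} (hT : ∀ i j, Commute (T i) (T j))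
    (j : Fin N) (f : Poly N) : opEval T (X j * f) = T j * opEval T f := by
  induction f using MvPolynomial.induction_on' with
  | add p q hp hq => rw [mul_add, map_add, map_add, hp, hq, mul_add]
  | monomial n c =>
    rw [show monomial n c = c • monomial n (1 : ℂ) by rw [smul_monomial, smul_eq_mul, mul_one],
      mul_smul_comm, map_smul, map_smul,
      mul_smul_comm]
    congr 1
    have h : (X j * monomial n 1 : Poly N) = monomial (Finsupp.single j 1 + n) 1 := by
      rw [X, monomial_mul, one_mul]
    rw [h, opEval_monomial, opEval_monomial]
    -- T_j becomes an ordered product whose only nontrivial factor is in slot j, so the two ordered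
    -- products can be merged factor by factor.
    conv_rhs => rw [← prod_ofFn_mulSingle j (T j)]
    rw [← prod_ofFn_mul_of_commute]
    · congr 2
      ext1 i
      rw [Finsupp.add_apply, pow_add]
      by_cases h : i = j
      · subst h; simp
      · simp [h]
    · intro i k
      by_cases h : i = j
      · subst h; simpa using (hT i k).pow_right _
      · simp [h]

theorem sigmaA_apply (β : ℕ) (f : Poly N) : sigmaA β f = opEval (creation β) f 1 := rfl

theorem sigmaA_one (β : ℕ) : sigmaA β (1 : Poly N) = 1 := by
  have := opEval_monomial (creation (N := N) β) 0
  rw [monomial_zero', C_1] at this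
  rw [sigmaA_apply, this, List.prod_eq_one]
  · rfl
  · intro y hy
    obtain ⟨i, rfl⟩ := (List.mem_ofFn' _ _).mp hy
    simp

theorem sigmaA_X_mul (β : ℕ) (j : Fin N) (f : Poly N) :
    sigmaA β (X j * f) = creation β j (sigmaA β f) := by
  rw [sigmaA_apply, opEval_X_mul (commute_creation β)]; rfl

theorem rename_creation (β : ℕ) (π : Equiv.Perm (Fin N)) (j : Fin N) (f : Poly N) :
    rename π (creation β j f) = creation β (π j) (rename π f) := by
  simp only [creation_apply, map_smul, map_sub, map_mul, rename_X, rename_dunkl]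

theorem rename_sigmaA (β : ℕ) (π : Equiv.Perm (Fin N)) (f : Poly N) :
    rename π (sigmaA β f) = sigmaA β (rename π f) := by
  induction f using poly_induction with
  | add f g hf hg => simp only [map_add, hf, hg]
  | smul c f hf => simp only [map_smul, hf]
  | one => simp [sigmaA_one]
  | X_mul k f hf => rw [sigmaA_X_mul, rename_creation, hf, map_mul, rename_X, sigmaA_X_mul]

theorem dunklComm_sigmaA (β : ℕ) (j k : Fin N) (f : Poly N) :
    dunklComm β j k (sigmaA β f) = sigmaA β (dunklComm β j k f) := by
  by_cases h : j = k
  · subst h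
    simp only [dunklComm_self, map_add, map_smul, map_sum, exch_apply, rename_sigmaA]
  · simp only [dunklComm_of_ne β h, map_neg, map_smul, exch_apply, rename_sigmaA]

/-- Since the D's commute, [D_j, ã†_k] = √2 [D_j, x_k], and the latter commutes with σ by
equivariance. Induction on multiplication by coordinates starts from D_j 1 = 0. -/
theorem dunkl_sigmaA (β : ℕ) (j : Fin N) (f : Poly N) :
    dunkl β j (sigmaA β f) = sqrtTwo • sigmaA β (dunkl β j f) := by
  induction f using poly_induction with
  | add f g hf hg => simp only [map_add, hf, hg, smul_add]
  | smul c f hf => simp only [map_smul, hf, smul_comm sqrtTwo c]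
  | one => simp [sigmaA_one, dunkl_one]
  | X_mul k f hf =>
    rw [sigmaA_X_mul, dunkl_X_mul, map_add, sigmaA_X_mul, ← dunklComm_sigmaA,
      creation_apply, creation_apply, map_smul, map_sub, map_smul, dunkl_X_mul, dunkl_comm β j k,
      hf, map_smul, mul_smul_comm]
    have h2 : (2 : ℂ) = sqrtTwo * sqrtTwo := sqrtTwo_mul_self.symm
    have h0 := sqrtTwo_ne_zero
    simp only [h2, smul_sub, smul_add, smul_smul]
    have e1 : sqrtTwo⁻¹ * (sqrtTwo * sqrtTwo) = sqrtTwo := by field_simp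
    have e3 : sqrtTwo⁻¹ * (sqrtTwo * sqrtTwo * sqrtTwo) = sqrtTwo * sqrtTwo := by field_simp
    have e4 : sqrtTwo⁻¹ * sqrtTwo = 1 := by field_simp
    have e5 : sqrtTwo * sqrtTwo⁻¹ = 1 := by field_simp
    simp only [e1, e3, e4, e5]
    abel

/-- The operator `x_j D_j`. -/
noncomputable def xD (β : ℕ) (j : Fin N) : Module.End ℂ (Poly N) := mulX j * dunkl β j

theorem xD_apply (β : ℕ) (j : Fin N) (f : Poly N) : xD β j f = X j * dunkl β j f := rfl

/-- The operator `ã†_j ã_j`. -/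
noncomputable def number (β : ℕ) (j : Fin N) : Module.End ℂ (Poly N) :=
  creation β j * (sqrtTwo⁻¹ • dunkl β j)

theorem number_apply (β : ℕ) (j : Fin N) (f : Poly N) :
    number β j f = sqrtTwo⁻¹ • creation β j (dunkl β j f) := by
  simp [number]

theorem number_sigmaA (β : ℕ) (j : Fin N) (f : Poly N) :
    number β j (sigmaA β f) = sigmaA β (xD β j f) := by
  rw [number_apply, xD_apply, sigmaA_X_mul, dunkl_sigmaA, map_smul, smul_smul,
    inv_mul_cancel₀ sqrtTwo_ne_zero, one_smul]

theorem rename_xD (β : ℕ) (π : Equiv.Perm (Fin N)) (j : Fin N) (f : Poly N) :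
    rename π (xD β j f) = xD β (π j) (rename π f) := by
  rw [xD_apply, xD_apply, map_mul, rename_X, rename_dunkl]

/-- The operator `∑_j (x_j D_j)²`. -/
noncomputable def calogero (β : ℕ) : Module.End ℂ (Poly N) := ∑ j : Fin N, xD β j * xD β j

theorem calogero_apply (β : ℕ) (f : Poly N) :
    calogero β f = ∑ j : Fin N, xD β j (xD β j f) := by
  simp [calogero]

theorem rename_calogero (β : ℕ) (π : Equiv.Perm (Fin N)) (f : Poly N) :
    rename π (calogero β f) = calogero β (rename π f) := by
  simp only [calogero_apply, map_sum, rename_xD]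
  exact Equiv.sum_comp π fun j => xD β j (xD β j (rename π f))

theorem sum_number_sigmaA (β : ℕ) (f : Poly N) :
    ∑ j : Fin N, number β j (number β j (sigmaA β f)) = sigmaA β (calogero β f) := by
  simp only [number_sigmaA, calogero_apply, map_sum]

/-! ### Restriction to symmetric polynomials and the Sutherland operator -/

theorem exch_of_isSymmetric {f : Poly N} (hf : f.IsSymmetric) (j k : Fin N) : exch j k f = f :=
  hf _

theorem dunkl_of_isSymmetric (β : ℕ) {f : Poly N} (hf : f.IsSymmetric) (j : Fin N) :
    dunkl β j f = pderiv j f := by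
  rw [dunkl_apply, Finset.sum_eq_zero fun k _ => divDiff_of_exch_eq (exch_of_isSymmetric hf j k)]
  simp

theorem sum_sum_Iio_add {M : Type*} [AddCommGroup M] (a : Fin N → M) :
    ∑ j, ∑ k ∈ Finset.Iio j, (a k + a j) = ((N : ℤ) - 1) • ∑ j, a j := by
  have h1 : ∑ j, ∑ k ∈ Finset.Iio j, a k = ∑ k, ∑ j ∈ Finset.Ioi k, a k := by
    rw [Finset.sum_comm' (t' := Finset.univ) (s' := fun k => Finset.Ioi k)]
    simp
  simp only [Finset.sum_add_distrib]
  rw [h1, ← Finset.sum_add_distrib, Finset.smul_sum]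
  refine Finset.sum_congr rfl fun j _ => ?_
  rw [Finset.sum_const, Finset.sum_const, Fin.card_Ioi, Fin.card_Iio, ← add_smul,
    ← natCast_zsmul]
  congr 1
  have := j.isLt
  omega

/-- On symmetric polynomials, the Sutherland operator is `∑_j (x_j D_j)²` up to a constant. -/
theorem sutherland_of_isSymmetric (N β : ℕ) : ∃ c : ℂ, ∀ f : Poly N, f.IsSymmetric →
    sutherland β f = calogero β f + c • f := by
  set b : ℂ := (β : ℂ) / 2 * ((N : ℂ) - 1) with hb
  refine ⟨∑ j : Fin N, ((β : ℂ) * (j : ℕ) - b) ^ 2, fun f hf => ?_⟩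
  have h1 : ∀ j : Fin N, (cherednik β j - b • 1 : Module.End ℂ (Poly N)) f
      = xD β j f + ((β : ℂ) * (j : ℕ) - b) • f := by
    intro j
    have : ∑ k ∈ Finset.Iio j, exch j k f = ((j : ℕ) : ℂ) • f := by
      rw [Finset.sum_congr rfl fun k _ => exch_of_isSymmetric hf j k, Finset.sum_const,
        Fin.card_Iio, Nat.cast_smul_eq_nsmul]
    simp only [cherednik, LinearMap.sub_apply, LinearMap.add_apply, LinearMap.smul_apply,
      LinearMap.sum_apply, Module.End.one_apply, this, sub_smul, smul_smul, xD]
    abel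
  have h2 : ∀ j : Fin N, ((cherednik β j - b • 1 : Module.End ℂ (Poly N)) ^ 2) f = xD β j (xD β j f)
      + ((β : ℂ) • ∑ k ∈ Finset.Iio j, (xD β k f + xD β j f) - (2 * b) • xD β j f)
      + (((β : ℂ) * (j : ℕ) - b) ^ 2) • f := by
    intro j
    rw [pow_two, Module.End.mul_apply, h1, map_add, map_smul, h1]
    have : ∑ k ∈ Finset.Iio j, exch j k (xD β j f) = ∑ k ∈ Finset.Iio j, xD β k f := by
      refine Finset.sum_congr rfl fun k _ => ?_
      rw [exch_apply, rename_xD, Equiv.swap_apply_left, hf]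
    rw [LinearMap.sub_apply, cherednik, LinearMap.add_apply, LinearMap.smul_apply,
      LinearMap.sum_apply, this, Finset.sum_add_distrib, Finset.sum_const, Fin.card_Iio,
      ← Nat.cast_smul_eq_nsmul ℂ]
    simp only [LinearMap.smul_apply, Module.End.one_apply, ← xD.eq_1]
    module
  -- Each x_j D_j f occurs N - 1 times in the double sum over pairs k < j; the shift b = β(N-1)/2 is
  -- exactly what cancels this first-order part.
  have h3 : ∑ j : Fin N, ((β : ℂ) • ∑ k ∈ Finset.Iio j, (xD β k f + xD β j f)
      - (2 * b) • xD β j f) = 0 := by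
    rw [Finset.sum_sub_distrib, ← Finset.smul_sum, ← Finset.smul_sum, sum_sum_Iio_add,
      ← Int.cast_smul_eq_zsmul ℂ, smul_smul, ← sub_smul, hb]
    push_cast
    ring_nf
    simp
  rw [sutherland, LinearMap.sum_apply, Finset.sum_congr rfl fun j _ => h2 j,
    Finset.sum_add_distrib, Finset.sum_add_distrib, h3, add_zero, ← calogero_apply,
    ← Finset.sum_smul]

/-! ### Supports of the images of monomials -/

/-- The exponent `κ` has the same degree as `ν`, and its partial sums are bounded by those of
rearrangements of `ν`. -/
def Below (κ ν : Fin N →₀ ℕ) : Prop :=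
  ∑ i, κ i = ∑ i, ν i ∧
    ∀ I : Finset (Fin N), ∃ I' : Finset (Fin N), I'.card = I.card ∧ ∑ i ∈ I, κ i ≤ ∑ i ∈ I', ν i

theorem Below.refl (ν : Fin N →₀ ℕ) : Below ν ν := ⟨rfl, fun I => ⟨I, rfl, le_rfl⟩⟩

theorem below_mapDomain (π : Equiv.Perm (Fin N)) (ν : Fin N →₀ ℕ) :
    Below (ν.mapDomain π) ν := by
  refine ⟨?_, fun I => ⟨I.map π.symm.toEmbedding, by simp, ?_⟩⟩
  · simp only [Finsupp.mapDomain_equiv_apply]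
    exact Equiv.sum_comp π.symm ν
  · simp [Finsupp.mapDomain_equiv_apply]

theorem Below.trans {κ ν ξ : Fin N →₀ ℕ} (h : Below κ ν) (h' : Below ν ξ) : Below κ ξ := by
  refine ⟨h.1.trans h'.1, fun I => ?_⟩
  obtain ⟨I', h1, h2⟩ := h.2 I
  obtain ⟨I'', h3, h4⟩ := h'.2 I'
  exact ⟨I'', h3.trans h1, h2.trans h4⟩

/-- A transfer of t units from j to k that does not exceed the gap lowers an exponent in dominance
order. The only subsets whose sum can grow contain k but not j, and for them j replaces k in the
comparison set. -/
theorem below_of_transfer {j k : Fin N} (hjk : j ≠ k) {κ ν : Fin N →₀ ℕ} {t : ℕ}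
    (ht : ν k + t ≤ ν j) (hj : κ j + t = ν j) (hk : κ k = ν k + t)
    (hi : ∀ i, i ≠ j → i ≠ k → κ i = ν i) : Below κ ν := by
  have both : ∀ I : Finset (Fin N), j ∈ I → k ∈ I → ∑ i ∈ I, κ i = ∑ i ∈ I, ν i := by
    intro I hjI hkI
    have hkI' : k ∈ I.erase j := Finset.mem_erase.mpr ⟨hjk.symm, hkI⟩
    rw [← Finset.add_sum_erase I κ hjI, ← Finset.add_sum_erase I ν hjI,
      ← Finset.add_sum_erase _ κ hkI', ← Finset.add_sum_erase _ ν hkI']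
    have : ∑ i ∈ (I.erase j).erase k, κ i = ∑ i ∈ (I.erase j).erase k, ν i :=
      Finset.sum_congr rfl fun i h =>
        hi i (Finset.ne_of_mem_erase (Finset.mem_of_mem_erase h)) (Finset.ne_of_mem_erase h)
    omega
  refine ⟨both _ (Finset.mem_univ j) (Finset.mem_univ k), fun I => ?_⟩
  by_cases hkI : k ∈ I
  · by_cases hjI : j ∈ I
    · exact ⟨I, rfl, (both I hjI hkI).le⟩
    · have hj' : j ∉ I.erase k := fun h => hjI (Finset.mem_of_mem_erase h)
      refine ⟨insert j (I.erase k), ?_, ?_⟩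
      · rw [Finset.card_insert_of_notMem hj', Finset.card_erase_add_one hkI]
      · rw [Finset.sum_insert hj', ← Finset.add_sum_erase I κ hkI]
        have : ∑ i ∈ I.erase k, κ i = ∑ i ∈ I.erase k, ν i :=
          Finset.sum_congr rfl fun i h =>
            hi i (fun e => hj' (e ▸ h)) (Finset.ne_of_mem_erase h)
        omega
  · refine ⟨I, rfl, Finset.sum_le_sum fun i h => ?_⟩
    by_cases hij : i = j
    · subst hij; omega
    · exact (hi i hij fun e => hkI (e ▸ h)).le

theorem exists_mem_support_of_mem_support_map (T : Module.End ℂ (Poly N)) {f : Poly N}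
    {κ : Fin N →₀ ℕ} (h : κ ∈ (T f).support) :
    ∃ ν ∈ f.support, κ ∈ (T (monomial ν 1)).support := by
  by_contra! hc
  rw [mem_support_iff, f.as_sum, map_sum, coeff_sum] at h
  refine h (Finset.sum_eq_zero fun ν hν => ?_)
  have : monomial ν (coeff ν f) = coeff ν f • monomial ν (1 : ℂ) := by
    rw [smul_monomial, smul_eq_mul, mul_one]
  rw [this, map_smul, coeff_smul, notMem_support_iff.mp (hc ν hν), smul_zero]

theorem exch_monomial (j k : Fin N) (ν : Fin N →₀ ℕ) :
    exch j k (monomial ν 1) = monomial (ν.mapDomain (Equiv.swap j k)) 1 := by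
  rw [exch_apply, rename_monomial]

theorem divDiff_mul_X_pow {j k : Fin N} (h : j ≠ k) {m : Poly N} (hm : exch j k m = m) (n : ℕ) :
    divDiff j k (m * X j ^ n) = ∑ c ∈ Finset.range n, m * (X j ^ c * X k ^ (n - 1 - c)) := by
  apply mul_left_cancel₀ (X_sub_X_ne_zero h)
  rw [X_sub_X_mul_divDiff h, exch_mul, hm, ← Finset.mul_sum, mul_left_comm,
    (Commute.all (X j : Poly N) (X k)).mul_geom_sum₂, mul_sub]
  simp [exch_apply]

/-- Write x^ν = m x_j^n with m invariant under s_jk. The divided difference is then m times a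
geometric sum, and after multiplication by x_j its term x_j^c x_k^(n-1-c) is a transfer of n-1-c
units from j to k. -/
theorem below_of_mem_support_divDiff_monomial {j k : Fin N} (h : j ≠ k) {ν κ : Fin N →₀ ℕ}
    (hν : ν k ≤ ν j) (hκ : κ ∈ (divDiff j k (monomial ν 1)).support) :
    Below (κ + Finsupp.single j 1) ν := by
  obtain ⟨n, hn⟩ := Nat.exists_eq_add_of_le hν
  set ξ : Fin N →₀ ℕ := ν - Finsupp.single j n with hξ
  have hξj : ξ j = ν k := by simp [hξ, hn]
  have hξi : ∀ i, i ≠ j → ξ i = ν i := fun i hi => by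
    simp [hξ, Finsupp.single_eq_of_ne hi]
  have hm : exch j k (monomial ξ 1) = monomial ξ 1 := by
    rw [exch_monomial]
    refine congrArg (fun η => monomial η (1 : ℂ)) (Finsupp.ext fun i => ?_)
    rw [Finsupp.mapDomain_equiv_apply, Equiv.symm_swap]
    rcases eq_or_ne i j with rfl | hj
    · rw [Equiv.swap_apply_left, hξi k h.symm, hξj]
    · rcases eq_or_ne i k with rfl | hk
      · rw [Equiv.swap_apply_right, hξi i h.symm, hξj]
      · rw [Equiv.swap_apply_of_ne_of_ne hj hk]
  have hmon : (monomial ν 1 : Poly N) = monomial ξ 1 * X j ^ n := by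
    rw [X_pow_eq_monomial, monomial_mul, one_mul]
    refine congrArg (fun η => monomial η (1 : ℂ)) (Finsupp.ext fun i => ?_)
    rcases eq_or_ne i j with rfl | hj
    · simp [hξj, hn]
    · simp [hξi i hj, Finsupp.single_eq_of_ne hj]
  rw [hmon, divDiff_mul_X_pow h hm, mem_support_iff, coeff_sum] at hκ
  obtain ⟨c, hc, hc'⟩ := Finset.exists_ne_zero_of_sum_ne_zero hκ
  rw [Finset.mem_range] at hc
  rw [X_pow_eq_monomial, X_pow_eq_monomial, monomial_mul, monomial_mul, coeff_monomial] at hc'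
  have hκ' : ξ + (Finsupp.single j c + Finsupp.single k (n - 1 - c)) = κ := by
    by_contra hne
    exact hc' (if_neg hne)
  refine below_of_transfer h (t := n - 1 - c) (by omega) ?_ ?_ ?_
  · simp [← hκ', hξj, Finsupp.single_eq_of_ne h]; omega
  · simp [← hκ', hξi k h.symm, Finsupp.single_eq_of_ne h.symm]
  · intro i hij hik
    simp [← hκ', hξi i hij, Finsupp.single_eq_of_ne hij, Finsupp.single_eq_of_ne hik]

/-- When ν_k exceeds ν_j, apply the monomial case to the swapped exponent: the divided difference
only changes sign, and a rearrangement of ν is still below ν. -/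
theorem exists_below_of_mem_support_divDiff {j k : Fin N} (h : j ≠ k) {f : Poly N}
    {κ : Fin N →₀ ℕ} (hκ : κ ∈ (divDiff j k f).support) :
    ∃ ν ∈ f.support, Below (κ + Finsupp.single j 1) ν := by
  obtain ⟨ν, hν, hκ⟩ := exists_mem_support_of_mem_support_map _ hκ
  refine ⟨ν, hν, ?_⟩
  rcases le_total (ν k) (ν j) with hle | hle
  · exact below_of_mem_support_divDiff_monomial h hle hκ
  · refine Below.trans (below_of_mem_support_divDiff_monomial h ?_ ?_)
      (below_mapDomain (Equiv.swap j k) ν)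
    · simpa [Finsupp.mapDomain_equiv_apply] using hle
    · rw [← exch_monomial, divDiff_exch, support_neg]; exact hκ

/-- The common source of two facts: D_j lowers the degree by one, and x_j D_j preserves dominance
bounds. -/
theorem exists_below_of_mem_support_dunkl {β : ℕ} {j : Fin N} {f : Poly N}
    {κ : Fin N →₀ ℕ} (hκ : κ ∈ (dunkl β j f).support) :
    ∃ ν ∈ f.support, Below (κ + Finsupp.single j 1) ν := by
  rw [dunkl_apply, mem_support_iff, coeff_add, coeff_smul, coeff_sum] at hκ
  by_cases h1 : coeff κ (pderiv j f) = 0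
  · rw [h1, zero_add, smul_eq_mul] at hκ
    obtain ⟨k, hk, hk'⟩ := Finset.exists_ne_zero_of_sum_ne_zero (right_ne_zero_of_mul hκ)
    exact exists_below_of_mem_support_divDiff (Finset.ne_of_mem_erase hk).symm
      (mem_support_iff.mpr hk')
  · refine ⟨κ + Finsupp.single j 1, mem_support_iff.mpr ?_, Below.refl _⟩
    rw [coeff_pderiv] at h1
    intro h
    simp [h] at h1

/-! ### Homogeneity -/

theorem isHomogeneous_iff {f : Poly N} {d : ℕ} :
    f.IsHomogeneous d ↔ ∀ κ ∈ f.support, ∑ i, κ i = d := by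
  have h : ∀ κ : Fin N →₀ ℕ, Finsupp.weight 1 κ = ∑ i, κ i := fun κ => by
    rw [← Finsupp.degree_eq_sum, Finsupp.degree_eq_weight_one]; rfl
  simp only [mem_support_iff]
  exact ⟨fun hf κ hκ => by rw [← h]; exact hf hκ, fun hf κ hκ => (h κ).trans (hf κ hκ)⟩

theorem sum_add_single (κ : Fin N →₀ ℕ) (j : Fin N) :
    ∑ i, (κ + Finsupp.single j 1 : Fin N →₀ ℕ) i = ∑ i, κ i + 1 := by
  simp [Finset.sum_add_distrib]

theorem sum_add_single_of_mem (κ : Fin N →₀ ℕ) {j : Fin N} {I : Finset (Fin N)} (h : j ∈ I) :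
    ∑ i ∈ I, (κ + Finsupp.single j 1 : Fin N →₀ ℕ) i = ∑ i ∈ I, κ i + 1 := by
  simp [Finset.sum_add_distrib, Finsupp.single_apply, h]

theorem sum_add_single_of_notMem (κ : Fin N →₀ ℕ) {j : Fin N} {I : Finset (Fin N)} (h : j ∉ I) :
    ∑ i ∈ I, (κ + Finsupp.single j 1 : Fin N →₀ ℕ) i = ∑ i ∈ I, κ i := by
  simp [Finset.sum_add_distrib, Finsupp.single_apply, h]

/-- The truncated d - 1 is harmless at d = 0, where the support of the image is empty. -/
theorem isHomogeneous_dunkl {β : ℕ} (j : Fin N) {f : Poly N} {d : ℕ} (hf : f.IsHomogeneous d) :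
    (dunkl β j f).IsHomogeneous (d - 1) := by
  rw [isHomogeneous_iff] at hf ⊢
  intro κ hκ
  obtain ⟨ν, hν, h⟩ := exists_below_of_mem_support_dunkl hκ
  have := hf ν hν
  have h1 := h.1
  rw [sum_add_single] at h1
  omega

theorem dunkl_of_isHomogeneous_zero {β : ℕ} (j : Fin N) {f : Poly N} (hf : f.IsHomogeneous 0) :
    dunkl β j f = 0 := by
  rw [isHomogeneous_iff] at hf
  rw [← support_eq_empty, Finset.eq_empty_iff_forall_notMem]
  intro κ hκ
  obtain ⟨ν, hν, h⟩ := exists_below_of_mem_support_dunkl hκ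
  have := hf ν hν
  have h1 := h.1
  rw [sum_add_single] at h1
  omega

theorem isHomogeneous_laplace {β : ℕ} {f : Poly N} {d : ℕ} (hf : f.IsHomogeneous d) :
    (laplace β f).IsHomogeneous (d - 2) := by
  rw [laplace_apply]
  exact IsHomogeneous.sum _ _ _ fun j _ => isHomogeneous_dunkl j (isHomogeneous_dunkl j hf)

theorem laplace_of_isHomogeneous_zero {β : ℕ} {f : Poly N} (hf : f.IsHomogeneous 0) :
    laplace β f = 0 := by
  rw [laplace_apply]
  exact Finset.sum_eq_zero fun j _ => by rw [dunkl_of_isHomogeneous_zero j hf, map_zero]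

theorem laplace_pow_of_isHomogeneous {β : ℕ} (n : ℕ) : ∀ {d : ℕ} {f : Poly N},
    f.IsHomogeneous d → d < n → (laplace β ^ n) f = 0 := by
  induction n with
  | zero => intro d f _ h; omega
  | succ n ih =>
    intro d f hf h
    rw [pow_succ, Module.End.mul_apply]
    by_cases hd : d = 0
    · subst hd
      rw [laplace_of_isHomogeneous_zero hf, map_zero]
    · exact ih (isHomogeneous_laplace hf) (by omega)

theorem isHomogeneous_xD {β : ℕ} (j : Fin N) {f : Poly N} {d : ℕ} (hf : f.IsHomogeneous d) :
    (xD β j f).IsHomogeneous d := by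
  rw [xD_apply]
  by_cases hd : d = 0
  · subst hd
    rw [dunkl_of_isHomogeneous_zero j hf, mul_zero]
    exact isHomogeneous_zero _ _ _
  · have := (isHomogeneous_X ℂ j).mul (isHomogeneous_dunkl (β := β) j hf)
    rwa [show 1 + (d - 1) = d by omega] at this

theorem isHomogeneous_calogero {β : ℕ} {f : Poly N} {d : ℕ} (hf : f.IsHomogeneous d) :
    (calogero β f).IsHomogeneous d := by
  rw [calogero_apply]
  exact IsHomogeneous.sum _ _ _ fun j _ => isHomogeneous_xD j (isHomogeneous_xD j hf)

/-! ### Dominance -/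

/-- All rearrangements of the exponent `ν` are weakly dominated by `lam`. -/
def Dom (lam : Fin N → ℕ) (ν : Fin N →₀ ℕ) : Prop :=
  ∀ (k : Fin N) (I : Finset (Fin N)), I.card = (Finset.Iic k).card →
    ∑ i ∈ I, ν i ≤ ∑ i ∈ Finset.Iic k, lam i

theorem Dom.of_below {lam : Fin N → ℕ} {κ ν : Fin N →₀ ℕ} (hν : Dom lam ν) (h : Below κ ν) :
    Dom lam κ := fun k I hI => by
  obtain ⟨I', h1, h2⟩ := h.2 I
  exact h2.trans (hν k I' (h1.trans hI))

theorem Dom.of_le {lam : Fin N → ℕ} {κ ν : Fin N →₀ ℕ} (hν : Dom lam ν) (h : κ ≤ ν) :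
    Dom lam κ := fun k I hI =>
  (Finset.sum_le_sum fun i _ => h i).trans (hν k I hI)

/-- The polynomials all of whose exponents are dominated by `lam`. -/
noncomputable def domSubmodule (lam : Fin N → ℕ) : Submodule ℂ (Poly N) :=
  restrictSupport ℂ {ν | Dom lam ν}

theorem mem_domSubmodule {lam : Fin N → ℕ} {f : Poly N} :
    f ∈ domSubmodule lam ↔ ∀ ν ∈ f.support, Dom lam ν := Iff.rfl

theorem exists_of_mem_support_X_mul {j : Fin N} {f : Poly N} {κ : Fin N →₀ ℕ}
    (hκ : κ ∈ (X j * f).support) : ∃ ξ ∈ f.support, ξ + Finsupp.single j 1 = κ := by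
  rw [support_X_mul, Finset.mem_map] at hκ
  obtain ⟨ξ, hξ, rfl⟩ := hκ
  exact ⟨ξ, hξ, add_comm _ _⟩

theorem X_mul_divDiff_mem_domSubmodule {lam : Fin N → ℕ} {j k : Fin N} (h : j ≠ k) {f : Poly N}
    (hf : f ∈ domSubmodule lam) : X j * divDiff j k f ∈ domSubmodule lam := by
  rw [mem_domSubmodule] at hf ⊢
  intro κ hκ
  obtain ⟨ξ, hξ, rfl⟩ := exists_of_mem_support_X_mul hκ
  obtain ⟨ν, hν, hb⟩ := exists_below_of_mem_support_divDiff h hξ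
  exact (hf ν hν).of_below hb

theorem xD_mem_domSubmodule {lam : Fin N → ℕ} {β : ℕ} (j : Fin N) {f : Poly N}
    (hf : f ∈ domSubmodule lam) : xD β j f ∈ domSubmodule lam := by
  rw [mem_domSubmodule] at hf ⊢
  intro κ hκ
  obtain ⟨ξ, hξ, rfl⟩ := exists_of_mem_support_X_mul hκ
  obtain ⟨ν, hν, hb⟩ := exists_below_of_mem_support_dunkl hξ
  exact (hf ν hν).of_below hb

theorem dunkl_mem_domSubmodule {lam : Fin N → ℕ} {β : ℕ} (j : Fin N) {f : Poly N}
    (hf : f ∈ domSubmodule lam) : dunkl β j f ∈ domSubmodule lam := by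
  rw [mem_domSubmodule] at hf ⊢
  intro κ hκ
  obtain ⟨ν, hν, hb⟩ := exists_below_of_mem_support_dunkl hκ
  exact ((hf ν hν).of_below hb).of_le le_self_add

theorem laplace_mem_domSubmodule {lam : Fin N → ℕ} {β : ℕ} {f : Poly N}
    (hf : f ∈ domSubmodule lam) : laplace β f ∈ domSubmodule lam := by
  rw [laplace_apply]
  exact sum_mem fun j _ => dunkl_mem_domSubmodule j (dunkl_mem_domSubmodule j hf)

theorem calogero_mem_domSubmodule {lam : Fin N → ℕ} {β : ℕ} {f : Poly N}
    (hf : f ∈ domSubmodule lam) : calogero β f ∈ domSubmodule lam := by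
  rw [calogero_apply]
  exact sum_mem fun j _ => xD_mem_domSubmodule j (xD_mem_domSubmodule j hf)

theorem exch_mem_domSubmodule {lam : Fin N → ℕ} (j k : Fin N) {f : Poly N}
    (hf : f ∈ domSubmodule lam) : exch j k f ∈ domSubmodule lam := by
  rw [mem_domSubmodule] at hf ⊢
  intro κ hκ
  obtain ⟨ν, hν, h⟩ := exists_mem_support_of_mem_support_map _ hκ
  rw [exch_monomial] at h
  have := support_monomial_subset h
  rw [Finset.mem_singleton] at this
  exact this ▸ (hf ν hν).of_below (below_mapDomain _ ν)

/-! ### Leading coefficients -/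

/-- The exponent of a monomial, as a finitely supported function. -/
noncomputable def expo (lam : Fin N → ℕ) : Fin N →₀ ℕ := Finsupp.equivFunOnFinite.symm lam

@[simp] theorem expo_apply (lam : Fin N → ℕ) (i : Fin N) : expo lam i = lam i := rfl

/-- If x^ξ x_b were x^λ, then x^ξ x_a would also occur, and its partial sum up to a would exceed
that of λ by one. -/
theorem coeff_X_mul_eq_zero {lam : Fin N → ℕ} {a b : Fin N} (hab : a < b) {h : Poly N}
    (hh : X a * h ∈ domSubmodule lam) : coeff (expo lam) (X b * h) = 0 := by
  by_contra hne
  obtain ⟨ξ, hξ, hξ'⟩ := exists_of_mem_support_X_mul (mem_support_iff.mpr hne)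
  have hmem : ξ + Finsupp.single a 1 ∈ (X a * h).support := by
    rw [mem_support_iff, add_comm, coeff_X_mul]
    exact mem_support_iff.mp hξ
  have h1 := hh hmem a (Finset.Iic a) rfl
  rw [sum_add_single_of_mem ξ (Finset.mem_Iic.mpr le_rfl)] at h1
  have h2 : ∑ i ∈ Finset.Iic a, expo lam i = ∑ i ∈ Finset.Iic a, ξ i := by
    rw [← hξ', sum_add_single_of_notMem ξ (by simpa using hab)]
  simp only [expo_apply] at h2
  omega

theorem coeff_X_mul_divDiff_of_lt {lam : Fin N → ℕ} {j k : Fin N} (h : j < k) {g : Poly N}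
    (hg : g ∈ domSubmodule lam) : coeff (expo lam) (X j * divDiff j k g)
      = coeff (expo lam) g - coeff (expo lam) (exch j k g) := by
  have h1 := X_mul_divDiff_mem_domSubmodule h.ne hg
  have h2 := coeff_X_mul_eq_zero h h1
  have h3 := congrArg (coeff (expo lam)) (X_sub_X_mul_divDiff h.ne g)
  rw [sub_mul, coeff_sub, coeff_sub, h2, sub_zero] at h3
  exact h3

/-- With q the divided difference, (x_j - x_k) q = g - s_jk g is dominated by λ, hence so is x_k q;
as k < j, x_j q cannot reach x^λ. -/
theorem coeff_X_mul_divDiff_of_gt {lam : Fin N → ℕ} {j k : Fin N} (h : k < j) {g : Poly N}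
    (hg : g ∈ domSubmodule lam) : coeff (expo lam) (X j * divDiff j k g) = 0 := by
  refine coeff_X_mul_eq_zero h ?_
  have : X k * divDiff j k g = X j * divDiff j k g - (g - exch j k g) := by
    rw [← X_sub_X_mul_divDiff h.ne']; ring
  rw [this]
  exact sub_mem (X_mul_divDiff_mem_domSubmodule h.ne' hg)
    (sub_mem hg (exch_mem_domSubmodule _ _ hg))

theorem coeff_X_mul_pderiv (j : Fin N) (f : Poly N) (κ : Fin N →₀ ℕ) :
    coeff κ (X j * pderiv j f) = κ j * coeff κ f := by
  rw [coeff_X_mul']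
  split_ifs with h
  · rw [coeff_pderiv, tsub_add_cancel_of_le]
    · rw [Finsupp.coe_tsub, Pi.sub_apply, Finsupp.single_eq_same, mul_comm, ← Nat.cast_add_one,
        Nat.sub_add_cancel (Nat.one_le_iff_ne_zero.mpr (Finsupp.mem_support_iff.mp h))]
    · simpa [Nat.one_le_iff_ne_zero] using Finsupp.mem_support_iff.mp h
  · rw [Finsupp.notMem_support_iff.mp h]; simp

/-- The leading coefficient of `∑_j (x_j D_j)²` on `m_λ`. -/
def energy (β : ℕ) (lam : Fin N → ℕ) : ℤ :=
  ∑ j, (lam j : ℤ) ^ 2 + β * ∑ j, ∑ k ∈ Finset.Ioi j, ((lam j : ℤ) - lam k)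

/-- On symmetric f the inner x_j D_j is x_j ∂_j. In the outer one, only divided differences with k >
j reach x^λ, and s_jk turns x_j D_j f into x_k D_k f, so each contributes λ_j - λ_k. -/
theorem coeff_calogero {lam : Fin N → ℕ} {β : ℕ} {f : Poly N} (hf : f.IsSymmetric)
    (hd : f ∈ domSubmodule lam) :
    coeff (expo lam) (calogero β f) = energy β lam * coeff (expo lam) f := by
  have key : ∀ j, coeff (expo lam) (xD β j (xD β j f))
      = ((lam j : ℂ) ^ 2 + β * ∑ k ∈ Finset.Ioi j, ((lam j : ℂ) - lam k))
        * coeff (expo lam) f := by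
    intro j
    have hg : xD β j f ∈ domSubmodule lam := xD_mem_domSubmodule j hd
    have hc : ∀ k, coeff (expo lam) (xD β k f) = lam k * coeff (expo lam) f := fun k => by
      rw [xD_apply, dunkl_of_isSymmetric β hf, coeff_X_mul_pderiv, expo_apply]
    have hk : ∀ k ∈ Finset.univ.erase j, coeff (expo lam) (X j * divDiff j k (xD β j f))
        = if j < k then ((lam j : ℂ) - lam k) * coeff (expo lam) f else 0 := by
      intro k hk
      split_ifs with h
      · rw [coeff_X_mul_divDiff_of_lt h hg, hc, exch_apply, rename_xD, Equiv.swap_apply_left,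
          hf, hc]
        ring
      · exact coeff_X_mul_divDiff_of_gt
          (lt_of_le_of_ne (not_lt.mp h) (Finset.ne_of_mem_erase hk)) hg
    rw [xD_apply, dunkl_apply, mul_add, coeff_add, coeff_X_mul_pderiv, hc, mul_smul_comm,
      Finset.mul_sum, coeff_smul, coeff_sum, Finset.sum_congr rfl hk, ← Finset.sum_filter]
    have hset : (Finset.univ.erase j).filter (j < ·) = Finset.Ioi j := by
      ext k
      simp only [Finset.mem_filter, Finset.mem_erase, Finset.mem_univ, Finset.mem_Ioi]
      exact ⟨fun h => h.2, fun h => ⟨⟨h.ne', trivial⟩, h⟩⟩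
    rw [hset, ← Finset.sum_mul, expo_apply, smul_eq_mul]
    ring
  rw [calogero_apply, coeff_sum, Finset.sum_congr rfl fun j _ => key j, ← Finset.sum_mul, energy,
    Finset.sum_add_distrib, ← Finset.mul_sum]
  push_cast
  rfl

/-! ### The intertwiner as an exponential -/

/-- The truncated exponential series of `-L/4` for the Dunkl Laplacian `L`. -/
noncomputable def expLaplace (β n : ℕ) : Module.End ℂ (Poly N) :=
  ∑ k ∈ Finset.range n, ((-1 / 4 : ℂ) ^ k / k.factorial) • laplace β ^ k

theorem expLaplace_apply (β n : ℕ) (f : Poly N) : expLaplace β n f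
    = ∑ k ∈ Finset.range n, ((-1 / 4 : ℂ) ^ k / k.factorial) • (laplace β ^ k) f := by
  simp [expLaplace]

theorem laplace_pow_X_mul (β : ℕ) (j : Fin N) (k : ℕ) (f : Poly N) :
    (laplace β ^ (k + 1)) (X j * f) = X j * (laplace β ^ (k + 1)) f
      + (2 * (k + 1) : ℂ) • dunkl β j ((laplace β ^ k) f) := by
  induction k with
  | zero => simp [laplace_X_mul]
  | succ k ih =>
    have hs : ∀ m, (laplace β ^ (m + 1)) f = laplace β ((laplace β ^ m) f) := fun m => by
      rw [pow_succ', Module.End.mul_apply]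
    rw [pow_succ', Module.End.mul_apply, ih, map_add, map_smul, laplace_X_mul, ← dunkl_laplace,
      Module.End.mul_apply, ← hs, ← hs]
    push_cast
    module

/-- A truncated form of exp(-L/4) x_j = (x_j - D_j/2) exp(-L/4), from [L^(k+1), x_j] = 2(k+1) D_j
L^k. The commutator lowers the power of L, hence the shorter truncation in the last term. -/
theorem expLaplace_X_mul (β n : ℕ) (j : Fin N) (f : Poly N) :
    expLaplace β (n + 1) (X j * f)
      = X j * expLaplace β (n + 1) f - (1 / 2 : ℂ) • dunkl β j (expLaplace β n f) := by
  rw [expLaplace_apply, expLaplace_apply, expLaplace_apply, Finset.sum_range_succ',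
    Finset.sum_range_succ', mul_add, Finset.mul_sum, map_sum, Finset.smul_sum, add_sub_right_comm,
    ← Finset.sum_sub_distrib]
  congr 1
  · refine Finset.sum_congr rfl fun k _ => ?_
    rw [laplace_pow_X_mul, smul_add, mul_smul_comm, map_smul, smul_smul, smul_smul, sub_eq_add_neg,
      ← neg_smul]
    congr 2
    have h1 : ((k : ℂ) + 1) ≠ 0 := Nat.cast_add_one_ne_zero k
    have h2 : (k.factorial : ℂ) ≠ 0 := Nat.cast_ne_zero.mpr k.factorial_ne_zero
    rw [Nat.factorial_succ]
    push_cast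
    field_simp
    ring
  · simp

theorem expLaplace_succ_of_isHomogeneous {β n d : ℕ} {f : Poly N} (hf : f.IsHomogeneous d)
    (h : d < n) : expLaplace β (n + 1) f = expLaplace β n f := by
  rw [expLaplace_apply, Finset.sum_range_succ, laplace_pow_of_isHomogeneous n hf h, smul_zero,
    add_zero, ← expLaplace_apply]

/-- Conjugation by exp(-L/4) sends x_j to x_j - D_j/2 = ã†_j/√2, and exp(-L/4) fixes 1; each degree
costs one √2. Any n > d already contains the whole series. -/
theorem sigmaA_monomial (β d : ℕ) : ∀ (ν : Fin N →₀ ℕ) (n : ℕ), ∑ i, ν i = d → d < n →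
    sigmaA β (monomial ν 1) = sqrtTwo ^ d • expLaplace β n (monomial ν 1) := by
  induction d with
  | zero =>
    intro ν n hν hn
    have h0 : ν = 0 := Finsupp.ext fun i => (Finset.sum_eq_zero_iff.mp hν) i (Finset.mem_univ i)
    obtain ⟨m, rfl⟩ := Nat.exists_eq_succ_of_ne_zero hn.ne'
    have h1 : laplace β (1 : Poly N) = 0 := laplace_of_isHomogeneous_zero (isHomogeneous_one _ _)
    subst h0
    rw [monomial_zero', C_1, sigmaA_one, expLaplace_apply, Finset.sum_range_succ',
      Finset.sum_eq_zero fun k _ => by rw [pow_succ (laplace β), Module.End.mul_apply, h1, map_zero,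
        smul_zero]]
    simp
  | succ d ih =>
    intro ν n hν hn
    obtain ⟨m, rfl⟩ := Nat.exists_eq_succ_of_ne_zero (Nat.ne_zero_of_lt hn)
    obtain ⟨j, -, hj⟩ : ∃ j ∈ Finset.univ, ν j ≠ 0 :=
      Finset.exists_ne_zero_of_sum_ne_zero (by omega)
    obtain ⟨ξ, rfl⟩ : ∃ ξ, ν = ξ + Finsupp.single j 1 :=
      ⟨ν - Finsupp.single j 1, (tsub_add_cancel_of_le (by
        simpa [Nat.one_le_iff_ne_zero] using hj)).symm⟩
    rw [sum_add_single] at hν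
    have hmon : (monomial (ξ + Finsupp.single j 1) 1 : Poly N) = X j * monomial ξ 1 := by
      rw [X, monomial_mul, one_mul, add_comm]
    have hhom : (monomial ξ 1 : Poly N).IsHomogeneous d := by
      rw [isHomogeneous_iff]
      intro κ hκ
      have := support_monomial_subset hκ
      rw [Finset.mem_singleton] at this
      subst this
      omega
    rw [hmon, sigmaA_X_mul, ih ξ m (by omega) (by omega), map_smul, creation_apply,
      Nat.succ_eq_add_one, expLaplace_X_mul,
      expLaplace_succ_of_isHomogeneous hhom (by omega), pow_succ, mul_smul]
    congr 1
    have e : sqrtTwo⁻¹ * 2 = sqrtTwo := by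
      rw [← sqrtTwo_mul_self, inv_mul_cancel_left₀ sqrtTwo_ne_zero]
    have e' : sqrtTwo * (1 / 2) = sqrtTwo⁻¹ := by
      nth_rewrite 1 [← e]; ring
    rw [smul_sub, smul_sub, smul_smul, smul_smul, e, e']

theorem sigmaA_of_isHomogeneous {β d n : ℕ} {f : Poly N} (hf : f.IsHomogeneous d) (h : d < n) :
    sigmaA β f = sqrtTwo ^ d • expLaplace β n f := by
  rw [isHomogeneous_iff] at hf
  rw [f.as_sum, map_sum, map_sum, Finset.smul_sum]
  refine Finset.sum_congr rfl fun ν hν => ?_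
  have : monomial ν (coeff ν f) = coeff ν f • monomial ν (1 : ℂ) := by
    rw [smul_monomial, smul_eq_mul, mul_one]
  rw [this, map_smul, map_smul, sigmaA_monomial β d ν n (hf ν hν) h, smul_comm]

theorem laplace_pow_mem_domSubmodule {lam : Fin N → ℕ} {β : ℕ} (k : ℕ) {f : Poly N}
    (hf : f ∈ domSubmodule lam) : (laplace β ^ k) f ∈ domSubmodule lam := by
  induction k with
  | zero => exact hf
  | succ k ih =>
    rw [pow_succ', Module.End.mul_apply]
    exact laplace_mem_domSubmodule ih

theorem sum_le_of_mem_support_laplace_pow {β k d : ℕ} {f : Poly N}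
    (hf : ∀ κ ∈ f.support, ∑ i, κ i ≤ d) :
    ∀ κ ∈ ((laplace β ^ k) f).support, ∑ i, κ i + 2 * k ≤ d := by
  induction k with
  | zero => exact hf
  | succ k ih =>
    intro κ hκ
    rw [pow_succ', Module.End.mul_apply, laplace_apply, mem_support_iff, coeff_sum] at hκ
    obtain ⟨j, -, hj⟩ := Finset.exists_ne_zero_of_sum_ne_zero hκ
    obtain ⟨ν, hν, h1⟩ := exists_below_of_mem_support_dunkl (mem_support_iff.mpr hj)
    obtain ⟨ξ, hξ, h2⟩ := exists_below_of_mem_support_dunkl hν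
    have := ih ξ hξ
    have h1 := h1.1
    have h2 := h2.1
    rw [sum_add_single] at h1 h2
    omega

/-- The intertwiner is triangular: up to a scalar, it changes a homogeneous polynomial only by terms
of lower degree that are dominated by the same partitions. -/
theorem sigmaA_sub_mem {lam : Fin N → ℕ} {β d : ℕ} {f : Poly N} (hf : f.IsHomogeneous d)
    (hd : f ∈ domSubmodule lam) :
    (sqrtTwo ^ d)⁻¹ • sigmaA β f - f ∈ domSubmodule lam ∧
      ∀ κ ∈ ((sqrtTwo ^ d)⁻¹ • sigmaA β f - f).support, ∑ i, κ i < d := by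
  have hs : (sqrtTwo ^ d)⁻¹ • sigmaA β f - f
      = ∑ k ∈ Finset.range d, ((-1 / 4 : ℂ) ^ (k + 1) / (k + 1).factorial)
          • (laplace β ^ (k + 1)) f := by
    rw [sigmaA_of_isHomogeneous hf (Nat.lt_succ_self d), smul_smul,
      inv_mul_cancel₀ (pow_ne_zero _ sqrtTwo_ne_zero), one_smul, expLaplace_apply,
      Finset.sum_range_succ']
    simp
  rw [hs]
  refine ⟨sum_mem fun k _ => Submodule.smul_mem _ _ (laplace_pow_mem_domSubmodule _ hd), ?_⟩
  intro κ hκ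
  rw [mem_support_iff, coeff_sum] at hκ
  obtain ⟨k, -, hk⟩ := Finset.exists_ne_zero_of_sum_ne_zero hκ
  rw [coeff_smul, smul_eq_mul] at hk
  have := sum_le_of_mem_support_laplace_pow (fun κ hκ => (isHomogeneous_iff.mp hf κ hκ).le) κ
    (mem_support_iff.mpr (right_ne_zero_of_mul hk))
  omega

/-! ### Monomial symmetric functions -/

theorem rename_mono (π : Equiv.Perm (Fin N)) (lam : Fin N → ℕ) : rename π (mono lam) = mono lam :=
  rename_msymm _ _ _ π

theorem isSymmetric_mono (lam : Fin N → ℕ) : (mono lam).IsSymmetric := fun π => rename_mono π lam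

theorem map_count_toMultiset (ν : Fin N →₀ ℕ) :
    ν.toMultiset.dedup.map ν.toMultiset.count
      = (Finset.univ.val.map ν).filter (· ≠ 0) := by
  have h1 : ν.toMultiset.dedup = (Finset.univ.filter fun i => ν i ≠ 0).val := by
    rw [← Multiset.toFinset_val, Finsupp.toFinset_toMultiset]
    congr 1
    ext i
    simp
  rw [h1, Multiset.filter_map]
  simp only [Finsupp.count_toMultiset, Finset.filter_val]
  rfl

/-- `Nat.Partition.ofMultiset` discards zero parts; no information is lost because the number of
parts is fixed at N. -/
theorem filter_ne_zero_eq_iff (a b : Fin N → ℕ) :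
    (Finset.univ.val.map a).filter (· ≠ 0) = (Finset.univ.val.map b).filter (· ≠ 0)
      ↔ Finset.univ.val.map a = Finset.univ.val.map b := by
  refine ⟨fun h => ?_, fun h => by rw [h]⟩
  have split : ∀ c : Fin N → ℕ, Finset.univ.val.map c
      = (Finset.univ.val.map c).filter (· ≠ 0)
        + Multiset.replicate (N - ((Finset.univ.val.map c).filter (· ≠ 0)).card) 0 := by
    intro c
    have h0 := Multiset.filter_add_not (· ≠ 0) (Finset.univ.val.map c)
    have h1 : (Finset.univ.val.map c).filter (fun x => ¬ x ≠ 0)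
        = Multiset.replicate ((Finset.univ.val.map c).filter (fun x => ¬ x ≠ 0)).card 0 :=
      Multiset.eq_replicate_card.mpr fun x hx => by simpa using (Multiset.mem_filter.mp hx).2
    have h2 := congrArg Multiset.card h0
    rw [Multiset.card_add, Multiset.card_map, Finset.card_val, Finset.card_univ,
      Fintype.card_fin] at h2
    conv_lhs => rw [← h0, h1]
    congr 2
    omega
  rw [split a, split b, h]

/-- Replaces the sum over multisets in `msymm` by a condition on exponents: x^ν comes from a single
multiset of indices, whose shape consists of the nonzero entries of ν. -/
theorem coeff_mono (lam : Fin N → ℕ) (ν : Fin N →₀ ℕ) :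
    coeff ν (mono lam)
      = if Finset.univ.val.map ν = Finset.univ.val.map lam then 1 else 0 := by
  have hterm : ∀ s : Multiset (Fin N),
      (s.map X).prod = (monomial (Multiset.toFinsupp s) 1 : Poly N) := by
    intro s
    induction s using Multiset.induction_on with
    | empty => simp
    | cons a s ih =>
      rw [Multiset.map_cons, Multiset.prod_cons, ih, X, monomial_mul, one_mul,
        ← Multiset.singleton_add, map_add, Multiset.toFinsupp_singleton]
  rw [mono, msymm, coeff_sum]
  simp only [hterm, coeff_monomial]
  have hshape : ∀ s : Sym (Fin N) (Finset.univ.val.map lam).sum,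
      Nat.Partition.ofSym s = Nat.Partition.ofMultiset (Finset.univ.val.map lam)
        ↔ Finset.univ.val.map (Multiset.toFinsupp s.1) = Finset.univ.val.map lam := by
    intro s
    rw [Nat.Partition.ext_iff, ← filter_ne_zero_eq_iff, ← map_count_toMultiset]
    simp only [Multiset.toFinsupp_toMultiset]
    rfl
  split_ifs with h
  · have hcard : Multiset.card ν.toMultiset = (Finset.univ.val.map lam).sum := by
      rw [Finsupp.card_toMultiset, ← h, Finsupp.sum_fintype _ _ (fun _ => rfl)]
      rfl
    have hs := (hshape ⟨ν.toMultiset, hcard⟩).mpr (by simpa using h)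
    rw [Finset.sum_eq_single ⟨⟨ν.toMultiset, hcard⟩, hs⟩]
    · simp
    · intro t _ ht
      rw [if_neg]
      rintro rfl
      exact ht (Subtype.ext (Subtype.ext (by simp)))
    · intro h'; exact absurd (Finset.mem_univ _) h'
  · refine Finset.sum_eq_zero fun t _ => if_neg ?_
    rintro rfl
    exact h ((hshape t.1).mp t.2)

theorem coeff_mono_self (lam : Fin N → ℕ) : coeff (expo lam) (mono lam) = 1 := by
  rw [coeff_mono, if_pos]; rfl

theorem mapDomain_eq_comp (π : Equiv.Perm (Fin N)) (ν : Fin N →₀ ℕ) :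
    ⇑(ν.mapDomain π) = ν ∘ π.symm :=
  funext fun _ => Finsupp.mapDomain_equiv_apply _ _

theorem coeff_mapDomain_of_isSymmetric {f : Poly N} (hf : f.IsSymmetric)
    (π : Equiv.Perm (Fin N)) (ν : Fin N →₀ ℕ) : coeff (ν.mapDomain π) f = coeff ν f := by
  conv_lhs => rw [← hf π]
  exact coeff_rename_mapDomain _ π.injective _ _

/-- Every sequence is a rearrangement of a partition. -/
theorem exists_antitone_mapDomain (ν : Fin N →₀ ℕ) :
    ∃ π : Equiv.Perm (Fin N), Antitone (ν.mapDomain π) := by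
  -- `Tuple.sort` orders increasingly, so it is combined with the reversal; the inverse appears
  -- because `mapDomain` precomposes with the inverse permutation.
  refine ⟨(Fin.revPerm.trans (Tuple.sort ν)).symm, ?_⟩
  rw [mapDomain_eq_comp]
  intro i j hij
  exact Tuple.monotone_sort ν (Fin.rev_le_rev.mpr hij)

theorem map_mapDomain (π : Equiv.Perm (Fin N)) (ν : Fin N →₀ ℕ) :
    Finset.univ.val.map (ν.mapDomain π) = Finset.univ.val.map ν := by
  rw [mapDomain_eq_comp, ← Multiset.map_map]
  congr 1
  have := Finset.map_univ_equiv π.symm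
  exact congrArg Finset.val this

theorem eq_of_antitone_of_map_eq {a b : Fin N → ℕ} (ha : Antitone a) (hb : Antitone b)
    (h : Finset.univ.val.map a = Finset.univ.val.map b) : a = b := by
  have h1 : ∀ c : Fin N → ℕ, Finset.univ.val.map c = (List.ofFn c : Multiset ℕ) := fun c => by
    rw [Fin.univ_val_map]
  rw [h1, h1, Multiset.coe_eq_coe] at h
  have hs : ∀ {c : Fin N → ℕ}, Antitone c → (List.ofFn c).Pairwise (· ≥ ·) := fun hc =>
    List.pairwise_ofFn.mpr fun i j hij => hc hij.le
  exact List.ofFn_injective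
    (h.eq_of_pairwise (fun _ _ _ _ h h' => le_antisymm h' h) (hs ha) (hs hb))

/-- A symmetric polynomial is a combination of the monomial symmetric functions of the partitions
in its support. -/
theorem mem_span_mono_of_isSymmetric {f : Poly N} (hf : f.IsSymmetric)
    {S : Set (Fin N → ℕ)} (hS : ∀ mu : Fin N → ℕ, Antitone mu → expo mu ∈ f.support → mu ∈ S) :
    f ∈ Submodule.span ℂ {p : Poly N | ∃ mu, Antitone mu ∧ mu ∈ S ∧ p = mono mu} := by
  classical
  -- Every permutation orbit of exponents contains exactly one antitone member, so coefficients need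
  -- only be compared there.
  have key : f = ∑ ν ∈ f.support.filter (fun ν : Fin N →₀ ℕ => Antitone ⇑ν),
      coeff ν f • mono ⇑ν := by
    ext κ
    obtain ⟨π, hπ⟩ := exists_antitone_mapDomain κ
    rw [coeff_sum, ← coeff_mapDomain_of_isSymmetric hf π κ]
    simp only [coeff_smul, coeff_mono, ← map_mapDomain π κ]
    by_cases h : κ.mapDomain π ∈ f.support
    · rw [Finset.sum_eq_single (κ.mapDomain π)]
      · simp
      · intro ν hν hne
        rw [if_neg, smul_zero]
        intro he
        exact hne (DFunLike.coe_injective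
          (eq_of_antitone_of_map_eq hπ (Finset.mem_filter.mp hν).2 he)).symm
      · intro h'
        exact absurd (Finset.mem_filter.mpr ⟨h, hπ⟩) h'
    · rw [notMem_support_iff.mp h, Finset.sum_eq_zero]
      intro ν hν
      rw [if_neg, smul_zero]
      intro he
      have := DFunLike.coe_injective
          (eq_of_antitone_of_map_eq hπ (Finset.mem_filter.mp hν).2 he)
      exact h (this ▸ (Finset.mem_filter.mp hν).1)
  rw [key]
  refine sum_mem fun ν hν => Submodule.smul_mem _ _ (Submodule.subset_span ?_)
  obtain ⟨h1, h2⟩ := Finset.mem_filter.mp hν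
  exact ⟨ν, h2, hS ν h2 (by convert h1; exact Finsupp.ext fun _ => rfl), rfl⟩

/-- Exchange argument: `I` and the initial segment differ by equally many indices on each side, and
the threshold value `mu k` separates the two kinds of entries. -/
theorem sum_le_sum_Iic_of_antitone {mu : Fin N → ℕ} (hmu : Antitone mu) (k : Fin N)
    {I : Finset (Fin N)} (hI : I.card = (Finset.Iic k).card) :
    ∑ i ∈ I, mu i ≤ ∑ i ∈ Finset.Iic k, mu i := by
  rw [← Finset.sum_inter_add_sum_sdiff I (Finset.Iic k) mu,
    ← Finset.sum_inter_add_sum_sdiff (Finset.Iic k) I mu, Finset.inter_comm]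
  refine Nat.add_le_add_left ?_ _
  calc ∑ i ∈ I \ Finset.Iic k, mu i ≤ (I \ Finset.Iic k).card • mu k :=
        Finset.sum_le_card_nsmul _ _ _ fun i hi => hmu (by
          have := (Finset.mem_sdiff.mp hi).2
          rw [Finset.mem_Iic, not_le] at this
          exact this.le)
    _ = (Finset.Iic k \ I).card • mu k := by rw [Finset.card_sdiff_comm hI]
    _ ≤ _ := Finset.card_nsmul_le_sum _ _ _ fun i hi =>
        hmu (Finset.mem_Iic.mp (Finset.mem_sdiff.mp hi).1)

theorem exists_mapDomain_of_mem_support_mono {mu : Fin N → ℕ} (hmu : Antitone mu)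
    {κ : Fin N →₀ ℕ} (hκ : κ ∈ (mono mu).support) :
    ∃ π : Equiv.Perm (Fin N), κ.mapDomain π = expo mu := by
  obtain ⟨π, hπ⟩ := exists_antitone_mapDomain κ
  rw [mem_support_iff, coeff_mono] at hκ
  have h : Finset.univ.val.map κ = Finset.univ.val.map mu := by
    by_contra h; exact hκ (if_neg h)
  rw [← map_mapDomain π] at h
  exact ⟨π, DFunLike.coe_injective (eq_of_antitone_of_map_eq hπ hmu h)⟩

theorem isHomogeneous_mono {mu : Fin N → ℕ} (hmu : Antitone mu) :
    (mono mu).IsHomogeneous (wt mu) := by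
  rw [isHomogeneous_iff]
  intro κ hκ
  obtain ⟨π, hπ⟩ := exists_mapDomain_of_mem_support_mono hmu hκ
  rw [← (below_mapDomain π κ).1, hπ]
  rfl

/-- Weak dominance of partitions of arbitrary weights. -/
def DomLE (mu lam : Fin N → ℕ) : Prop :=
  ∀ k : Fin N, ∑ i ∈ Finset.Iic k, mu i ≤ ∑ i ∈ Finset.Iic k, lam i

theorem domLE_of_dom {mu lam : Fin N → ℕ} (h : Dom lam (expo mu)) : DomLE mu lam :=
  fun k => h k (Finset.Iic k) rfl

theorem mono_mem_domSubmodule {mu lam : Fin N → ℕ} (hmu : Antitone mu) (h : DomLE mu lam) :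
    mono mu ∈ domSubmodule lam := by
  rw [mem_domSubmodule]
  intro κ hκ
  obtain ⟨π, hπ⟩ := exists_mapDomain_of_mem_support_mono hmu hκ
  have hκ' : κ = (expo mu).mapDomain π.symm := by
    rw [← hπ, ← Finsupp.mapDomain_comp]
    simp
  rw [hκ']
  exact Dom.of_below (fun k I hI => (sum_le_sum_Iic_of_antitone hmu k hI).trans (h k))
    (below_mapDomain _ _)

/-! ### The dominance order -/

theorem DomLE.trans {a b c : Fin N → ℕ} (h : DomLE a b) (h' : DomLE b c) : DomLE a c :=
  fun k => (h k).trans (h' k)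

theorem DomLE.antisymm {a b : Fin N → ℕ} (h : DomLE a b) (h' : DomLE b a) : a = b := by
  have hs : ∀ (c : Fin N → ℕ) k, ∑ i ∈ Finset.Iic k, c i = c k + ∑ i ∈ Finset.Iio k, c i :=
    fun c k => by rw [← Finset.Iio_insert, Finset.sum_insert (by simp)]
  funext k
  induction k using WellFoundedLT.induction with
  | ind k ih =>
    have h1 : ∑ i ∈ Finset.Iio k, a i = ∑ i ∈ Finset.Iio k, b i :=
      Finset.sum_congr rfl fun i hi => ih i (Finset.mem_Iio.mp hi)
    have h2 := le_antisymm (h k) (h' k)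
    rw [hs, hs, h1] at h2
    exact Nat.add_right_cancel h2

theorem DomLT.trans {a b c : Fin N → ℕ} (h : DomLT a b) (h' : DomLT b c) : DomLT a c := by
  refine ⟨?_, DomLE.trans h.2 h'.2⟩
  rintro rfl
  exact h.1 (DomLE.antisymm h.2 h'.2)

theorem DomLTSame.trans {a b c : Fin N → ℕ} (h : DomLTSame a b) (h' : DomLTSame b c) :
    DomLTSame a c :=
  ⟨h.1.trans h'.1, h.2.trans h'.2⟩

/-- The sum of the partial sums of a sequence. -/
def height (lam : Fin N → ℕ) : ℕ := ∑ k, ∑ i ∈ Finset.Iic k, lam i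

/-- Provides the natural-number measure for inductions along dominance, across all weights at once.
-/
theorem height_lt_of_domLT {mu lam : Fin N → ℕ} (h : DomLT mu lam) : height mu < height lam := by
  refine lt_of_le_of_ne (Finset.sum_le_sum fun k _ => h.2 k) fun he => h.1 ?_
  have := (Finset.sum_eq_sum_iff_of_le fun k _ => h.2 k).mp he
  exact DomLE.antisymm h.2 fun k => (this k (Finset.mem_univ k)).ge

/-- If `q_μ` is `m_μ` plus a combination of smaller monomial symmetric functions for all `μ`, then
`m_λ` is a combination of the `q_μ` with `μ ≤ λ`. -/
theorem mono_mem_span_of_triangular {R : (Fin N → ℕ) → (Fin N → ℕ) → Prop}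
    (hR : ∀ {a b}, R a b → DomLT a b) (hRt : ∀ {a b c}, R a b → R b c → R a c)
    {q : (Fin N → ℕ) → Poly N} {lam : Fin N → ℕ} (hlam : Antitone lam)
    (hq : ∀ mu, Antitone mu → mu = lam ∨ R mu lam → IsMonicTriangular R mu (q mu)) :
    mono lam ∈ Submodule.span ℂ {p | ∃ mu, Antitone mu ∧ (mu = lam ∨ R mu lam) ∧ p = q mu} := by
  induction hn : height lam using Nat.strong_induction_on generalizing lam with
  | _ n ih =>
    subst hn
    have h1 : q lam - mono lam
        ∈ Submodule.span ℂ {p | ∃ mu, Antitone mu ∧ (mu = lam ∨ R mu lam) ∧ p = q mu} := by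
      refine Submodule.span_le.mpr ?_ (hq lam hlam (Or.inl rfl))
      rintro _ ⟨mu, hmu, hlt, rfl⟩
      have hsub : ∀ nu, nu = mu ∨ R nu mu → nu = lam ∨ R nu lam := by
        rintro nu (rfl | h)
        · exact Or.inr hlt
        · exact Or.inr (hRt h hlt)
      refine Submodule.span_mono ?_ (ih _ (height_lt_of_domLT (hR hlt)) hmu
        (fun nu hnu h => hq nu hnu (hsub nu h)) rfl)
      rintro _ ⟨nu, hnu, h, rfl⟩
      exact ⟨nu, hnu, hsub nu h, rfl⟩
    have h2 := Submodule.sub_mem _ (Submodule.subset_span ⟨lam, hlam, Or.inl rfl, rfl⟩ :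
      q lam ∈ Submodule.span ℂ {p | ∃ mu, Antitone mu ∧ (mu = lam ∨ R mu lam) ∧ p = q mu}) h1
    rwa [sub_sub_cancel] at h2

/-! ### Summation by parts and strict monotonicity of the energy -/

theorem sum_mul_nonneg_of_partial_sums {n : ℕ} (a c : Fin n → ℤ)
    (ha : ∀ k, 0 ≤ ∑ i ∈ Finset.Iic k, a i) (hc : Antitone c) (hc0 : ∀ k, 0 ≤ c k) :
    0 ≤ ∑ i, a i * c i := by
  induction n with
  | zero => simp
  | succ n ih =>
    have hl : 0 ≤ ∑ i, a i := by
      have := ha (Fin.last n)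
      have he : Finset.Iic (Fin.last n) = Finset.univ := by ext i; simp [Fin.le_last]
      rwa [he] at this
    -- Abel summation, one step at a time: subtracting the last value of c keeps the remaining
    -- values nonnegative and antitone and splits off the total of a times that value.
    have h1 := ih (fun i => a i.castSucc) (fun i => c i.castSucc - c (Fin.last n)) (fun k => by
        have := ha k.castSucc
        have he : Finset.Iic k.castSucc = (Finset.Iic k).map Fin.castSuccEmb := by
          ext i
          simp only [Finset.mem_Iic, Finset.mem_map, Fin.coe_castSuccEmb]
          refine
            ⟨fun h => ⟨i.castPred (ne_of_lt (h.trans_lt (Fin.castSucc_lt_last k))), ?_, by simp⟩,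
            ?_⟩
          · exact Fin.castSucc_le_castSucc_iff.mp (by simpa using h)
          · rintro ⟨j, hj, rfl⟩
            exact Fin.castSucc_le_castSucc_iff.mpr hj
        rwa [he, Finset.sum_map] at this)
      (fun i j hij => sub_le_sub_right (hc (Fin.castSucc_le_castSucc_iff.mpr hij)) _)
      (fun k => sub_nonneg.mpr (hc (Fin.le_last _)))
    have h2 : ∑ i, a i * c i = ∑ i : Fin n, a i.castSucc * (c i.castSucc - c (Fin.last n))
        + (∑ i, a i) * c (Fin.last n) := by
      rw [Fin.sum_univ_castSucc, Fin.sum_univ_castSucc a]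
      simp only [mul_sub, Finset.sum_sub_distrib, add_mul, ← Finset.sum_mul]
      ring
    rw [h2]
    exact add_nonneg h1 (mul_nonneg hl (hc0 _))

/-- When a has total zero, c may be shifted by a constant; ∑ |c_j| is large enough to make it
nonnegative. -/
theorem sum_mul_nonneg_of_sum_eq_zero {n : ℕ} (a c : Fin n → ℤ)
    (ha : ∀ k, 0 ≤ ∑ i ∈ Finset.Iic k, a i) (ha0 : ∑ i, a i = 0) (hc : Antitone c) :
    0 ≤ ∑ i, a i * c i := by
  have h := sum_mul_nonneg_of_partial_sums a (fun i => c i + ∑ j, |c j|) ha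
    (fun i j hij => add_le_add_left (hc hij) _) (fun k => by
      have h1 := Finset.single_le_sum (f := fun j => |c j|) (fun j _ => abs_nonneg _)
        (Finset.mem_univ k)
      have h2 := neg_abs_le (c k)
      linarith)
  simpa [mul_add, Finset.sum_add_distrib, ← Finset.sum_mul, ha0] using h

theorem sum_sum_Ioi_sub (x : Fin N → ℤ) :
    ∑ j, ∑ k ∈ Finset.Ioi j, (x j - x k) = ∑ j, x j * ((N : ℤ) - 1 - 2 * (j : ℕ)) := by
  have h1 : ∑ j, ∑ k ∈ Finset.Ioi j, x k = ∑ k, ∑ j ∈ Finset.Iio k, x k := by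
    rw [Finset.sum_comm' (t' := Finset.univ) (s' := fun k => Finset.Iio k)]
    simp
  simp only [Finset.sum_sub_distrib]
  rw [h1, ← Finset.sum_sub_distrib]
  refine Finset.sum_congr rfl fun j _ => ?_
  rw [Finset.sum_const, Finset.sum_const, Fin.card_Ioi, Fin.card_Iio, nsmul_eq_mul, nsmul_eq_mul]
  have := j.isLt
  rw [Nat.cast_sub (by omega), Nat.cast_sub (by omega)]
  push_cast
  ring

/-- With x = λ - μ, the difference is ∑ x_i² + 2 ∑ x_i μ_i + β ∑ x_i (N-1-2i). The partial sums of x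
are nonnegative with total zero, so the last two sums are nonnegative by Abel summation; the first
is positive since λ ≠ μ. -/
theorem energy_lt_energy {β : ℕ} {mu lam : Fin N → ℕ} (hmu : Antitone mu)
    (h : DomLTSame mu lam) : energy β mu < energy β lam := by
  obtain ⟨hw, hne, hle⟩ := h
  set x : Fin N → ℤ := fun i => (lam i : ℤ) - mu i with hx
  have hx1 : ∀ k, 0 ≤ ∑ i ∈ Finset.Iic k, x i := fun k => by
    have := hle k
    rw [hx, Finset.sum_sub_distrib, sub_nonneg]
    exact_mod_cast this
  have hx0 : ∑ i, x i = 0 := by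
    rw [hx, Finset.sum_sub_distrib, sub_eq_zero]
    exact_mod_cast hw.symm
  have h1 : 0 ≤ ∑ i, x i * (mu i : ℤ) :=
    sum_mul_nonneg_of_sum_eq_zero x _ hx1 hx0 fun i j hij => Int.ofNat_le.mpr (hmu hij)
  have h2 : 0 ≤ ∑ i, x i * ((N : ℤ) - 1 - 2 * (i : ℕ)) :=
    sum_mul_nonneg_of_sum_eq_zero x _ hx1 hx0 fun i j hij => by
      have : (i : ℕ) ≤ (j : ℕ) := hij
      omega
  have h3 : 0 < ∑ i, x i ^ 2 := by
    obtain ⟨i, hi⟩ := Function.ne_iff.mp hne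
    refine Finset.sum_pos' (fun i _ => sq_nonneg _) ⟨i, Finset.mem_univ i, ?_⟩
    have : x i ≠ 0 := fun h0 => hi (by simp only [hx] at h0; omega)
    positivity
  have h4 : energy β lam - energy β mu = ∑ i, x i ^ 2 + 2 * ∑ i, x i * (mu i : ℤ)
      + β * ∑ i, x i * ((N : ℤ) - 1 - 2 * (i : ℕ)) := by
    rw [energy, energy, sum_sum_Ioi_sub fun i => (lam i : ℤ), sum_sum_Ioi_sub fun i => (mu i : ℤ)]
    have : ∀ a b c d : ℤ, a + (β : ℤ) * b - (c + β * d) = (a - c) + β * (b - d) := by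
      intros; ring
    rw [this, ← Finset.sum_sub_distrib, ← Finset.sum_sub_distrib, Finset.mul_sum, Finset.mul_sum,
      Finset.mul_sum, ← Finset.sum_add_distrib, ← Finset.sum_add_distrib, ← Finset.sum_add_distrib]
    exact Finset.sum_congr rfl fun i _ => by simp only [hx]; ring
  have h5 : 0 ≤ (β : ℤ) * ∑ i, x i * ((N : ℤ) - 1 - 2 * (i : ℕ)) :=
    mul_nonneg (Int.natCast_nonneg β) h2
  linarith

/-! ### Gaussian integrals of polynomials -/

theorem integrable_pow_mul_exp_neg_sq (n : ℕ) :
    MeasureTheory.Integrable fun x : ℝ => x ^ n * Real.exp (-x ^ 2) := by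
  have h := integrable_rpow_mul_exp_neg_mul_sq (b := 1) one_pos (s := n)
    (by have := n.cast_nonneg (α := ℝ); linarith)
  simpa [Real.rpow_natCast] using h

/-- The moments of the Gaussian `e^{-x²}`. -/
noncomputable def moment (n : ℕ) : ℝ := ∫ x : ℝ, x ^ n * Real.exp (-x ^ 2)

/-- The derivative of x^n e^{-x²} has integral zero. At n = 0 the truncated index is masked by the
factor n. -/
theorem natCast_mul_moment (n : ℕ) : n * moment (n - 1) = 2 * moment (n + 1) := by
  have hd : ∀ x : ℝ, HasDerivAt (fun x : ℝ => x ^ n * Real.exp (-x ^ 2))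
      (n * (x ^ (n - 1) * Real.exp (-x ^ 2)) - 2 * (x ^ (n + 1) * Real.exp (-x ^ 2))) x := by
    intro x
    have h1 : HasDerivAt (fun x : ℝ => -x ^ 2) (-(2 * x)) x := by
      simpa using (hasDerivAt_pow 2 x).fun_neg
    exact ((hasDerivAt_pow n x).fun_mul h1.exp).congr_deriv (by ring)
  have hi1 := (integrable_pow_mul_exp_neg_sq (n - 1)).const_mul (n : ℝ)
  have hi2 := (integrable_pow_mul_exp_neg_sq (n + 1)).const_mul (2 : ℝ)
  have h := MeasureTheory.integral_eq_zero_of_hasDerivAt_of_integrable hd (hi1.sub hi2)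
    (integrable_pow_mul_exp_neg_sq n)
  rw [MeasureTheory.integral_sub hi1 hi2, MeasureTheory.integral_const_mul,
    MeasureTheory.integral_const_mul, sub_eq_zero] at h
  exact h

/-- The Gaussian weight `e^{-x_1² - ⋯ - x_N²}`. -/
noncomputable def gaussWeight (x : Fin N → ℝ) : ℝ := ∏ j, Real.exp (-x j ^ 2)

theorem prod_pow_mul_gaussWeight (ν : Fin N →₀ ℕ) (x : Fin N → ℝ) :
    (∏ i, (x i : ℂ) ^ ν i) * (gaussWeight x : ℂ)
      = ∏ i, ((x i ^ ν i * Real.exp (-x i ^ 2) : ℝ) : ℂ) := by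
  rw [gaussWeight, Complex.ofReal_prod, ← Finset.prod_mul_distrib]
  push_cast
  rfl

theorem eval_mul_gaussWeight (p : Poly N) (x : Fin N → ℝ) :
    eval (fun i => (x i : ℂ)) p * (gaussWeight x : ℂ)
      = ∑ ν ∈ p.support, coeff ν p * ∏ i, ((x i ^ ν i * Real.exp (-x i ^ 2) : ℝ) : ℂ) := by
  rw [eval_eq', Finset.sum_mul]
  exact Finset.sum_congr rfl fun ν _ => by rw [mul_assoc, prod_pow_mul_gaussWeight]

theorem integrable_prod_pow (ν : Fin N →₀ ℕ) : MeasureTheory.Integrable fun x : Fin N → ℝ =>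
    ∏ i, ((x i ^ ν i * Real.exp (-x i ^ 2) : ℝ) : ℂ) :=
  MeasureTheory.Integrable.fintype_prod
    (f := fun i (t : ℝ) => ((t ^ ν i * Real.exp (-t ^ 2) : ℝ) : ℂ))
    fun i => (integrable_pow_mul_exp_neg_sq (ν i)).ofReal

theorem integrable_eval_mul_gaussWeight (p : Poly N) :
    MeasureTheory.Integrable fun x : Fin N → ℝ =>
      eval (fun i => (x i : ℂ)) p * (gaussWeight x : ℂ) := by
  simp only [eval_mul_gaussWeight]
  exact MeasureTheory.integrable_finsetSum _ fun ν _ => (integrable_prod_pow ν).const_mul _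

/-- The Gaussian integral of a polynomial. -/
noncomputable def gaussInt : Poly N →ₗ[ℂ] ℂ where
  toFun p := ∫ x : Fin N → ℝ, eval (fun i => (x i : ℂ)) p * (gaussWeight x : ℂ)
  map_add' p q := by
    rw [← MeasureTheory.integral_add (integrable_eval_mul_gaussWeight p)
      (integrable_eval_mul_gaussWeight q)]
    simp only [map_add, add_mul]
  map_smul' c p := by
    rw [RingHom.id_apply, smul_eq_mul, ← MeasureTheory.integral_const_mul]
    simp only [smul_eval, mul_assoc]

theorem gaussInt_apply (p : Poly N) : gaussInt p
    = ∫ x : Fin N → ℝ, eval (fun i => (x i : ℂ)) p * (gaussWeight x : ℂ) := rfl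

theorem gaussInt_monomial (ν : Fin N →₀ ℕ) (c : ℂ) :
    gaussInt (monomial ν c) = c * ∏ i, (moment (ν i) : ℂ) := by
  have h : ∀ x : Fin N → ℝ, eval (fun i => (x i : ℂ)) (monomial ν c) * (gaussWeight x : ℂ)
      = c * ∏ i, ((x i ^ ν i * Real.exp (-x i ^ 2) : ℝ) : ℂ) := fun x => by
    rw [eval_monomial, Finsupp.prod_fintype _ _ fun _ => pow_zero _, mul_assoc,
      prod_pow_mul_gaussWeight]
  rw [gaussInt_apply]
  simp only [h]
  rw [MeasureTheory.integral_const_mul, MeasureTheory.integral_fintype_prod_volume_eq_prod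
    (f := fun i (t : ℝ) => ((t ^ ν i * Real.exp (-t ^ 2) : ℝ) : ℂ))]
  simp only [integral_complex_ofReal, moment]

theorem gaussInt_pderiv (j : Fin N) (p : Poly N) :
    gaussInt (pderiv j p) = 2 * gaussInt (X j * p) := by
  induction p using MvPolynomial.induction_on' with
  | add p q hp hq => rw [map_add, map_add, hp, hq, mul_add, map_add, mul_add]
  | monomial ν c =>
    rw [pderiv_monomial, X, monomial_mul, gaussInt_monomial, gaussInt_monomial,
      ← Finset.mul_prod_erase _ _ (Finset.mem_univ j),
      ← Finset.mul_prod_erase _ _ (Finset.mem_univ j)]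
    have hr : ∀ i ∈ Finset.univ.erase j, (moment ((ν - Finsupp.single j 1 : Fin N →₀ ℕ) i) : ℂ)
        = moment ((Finsupp.single j 1 + ν : Fin N →₀ ℕ) i) := fun i hi => by
      simp [Finsupp.single_eq_of_ne (Finset.ne_of_mem_erase hi)]
    rw [Finset.prod_congr rfl hr]
    have h1 : (ν j : ℂ) * moment (ν j - 1) = 2 * moment (1 + ν j) := by
      rw [add_comm]
      exact_mod_cast congrArg Complex.ofReal (natCast_mul_moment (ν j))
    simp only [Finsupp.coe_tsub, Finsupp.coe_add, Pi.sub_apply, Pi.add_apply,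
      Finsupp.single_eq_same]
    linear_combination c * (∏ i ∈ Finset.univ.erase j,
      (moment ((Finsupp.single j 1 : Fin N →₀ ℕ) i + ν i) : ℂ)) * h1

theorem gaussInt_rename (π : Equiv.Perm (Fin N)) (p : Poly N) :
    gaussInt (rename π p) = gaussInt p := by
  induction p using MvPolynomial.induction_on' with
  | add p q hp hq => rw [map_add, map_add, map_add, hp, hq]
  | monomial ν c =>
    rw [rename_monomial, gaussInt_monomial, gaussInt_monomial]
    simp only [Finsupp.mapDomain_equiv_apply]
    rw [Equiv.prod_comp π.symm fun i => (moment (ν i) : ℂ)]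

/-! ### The weight function -/

/-- The product of `x_j - x_k` over all ordered pairs `j ≠ k`. -/
noncomputable def discr (N : ℕ) : Poly N :=
  ∏ p ∈ (Finset.univ : Finset (Fin N)).offDiag, (X p.1 - X p.2)

theorem rename_discr (π : Equiv.Perm (Fin N)) : rename π (discr N) = discr N := by
  simp only [discr, map_prod, map_sub, rename_X]
  exact Finset.prod_equiv (Equiv.prodCongr π π) (by simp) (by simp)

/-- The quotient of `discr` by `x_j - x_k`. -/
noncomputable def discrDiv (j k : Fin N) : Poly N :=
  ∏ p ∈ (Finset.univ : Finset (Fin N)).offDiag.erase (j, k), (X p.1 - X p.2)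

theorem X_sub_X_mul_discrDiv {j k : Fin N} (h : j ≠ k) :
    (X j - X k) * discrDiv j k = discr N :=
  Finset.mul_prod_erase (Finset.univ : Finset (Fin N)).offDiag
    (fun p => (X p.1 - X p.2 : Poly N)) (a := (j, k)) (by simpa using h)

theorem discrDiv_comm {j k : Fin N} (h : j ≠ k) : discrDiv k j = -discrDiv j k := by
  apply mul_left_cancel₀ (X_sub_X_ne_zero h)
  have h1 := X_sub_X_mul_discrDiv h
  have h2 := X_sub_X_mul_discrDiv h.symm
  linear_combination h1 - h2

theorem derivation_prod {ι A : Type*} [CommRing A] [Algebra ℂ A] [DecidableEq ι]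
    (D : Derivation ℂ A A) (s : Finset ι) (f : ι → A) :
    D (∏ i ∈ s, f i) = ∑ i ∈ s, (∏ j ∈ s.erase i, f j) * D (f i) := by
  induction s using Finset.induction_on with
  | empty => simp
  | insert a s ha ih =>
    rw [Finset.prod_insert ha, Derivation.leibniz, ih, Finset.sum_insert ha,
      Finset.erase_insert ha, smul_eq_mul, smul_eq_mul, Finset.mul_sum, add_comm]
    congr 1
    refine Finset.sum_congr rfl fun i hi => ?_
    have hai : a ≠ i := fun e => ha (e ▸ hi)
    rw [Finset.erase_insert_of_ne hai, Finset.prod_insert fun h => ha (Finset.mem_of_mem_erase h),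
      mul_assoc]

/-- The factors x_j - x_k and x_k - x_j contribute equally: the sign of the derivative and the sign
of the cofactor both flip. Hence the 2. -/
theorem pderiv_discr (j : Fin N) :
    pderiv j (discr N) = 2 * ∑ k ∈ Finset.univ.erase j, discrDiv j k := by
  classical
  rw [discr, derivation_prod]
  have h1 : ∀ p ∈ (Finset.univ : Finset (Fin N)).offDiag,
      (∏ q ∈ (Finset.univ : Finset (Fin N)).offDiag.erase p, (X q.1 - X q.2 : Poly N))
        * pderiv j (X p.1 - X p.2 : Poly N)
      = (if p.1 = j then discrDiv p.1 p.2 else 0) - (if p.2 = j then discrDiv p.1 p.2 else 0) := by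
    intro p _
    rw [map_sub, pderiv_X, pderiv_X, mul_sub]
    simp only [Pi.single_apply, discrDiv, mul_ite, mul_one, mul_zero]
  rw [Finset.sum_congr rfl h1, Finset.sum_sub_distrib,
    Finset.sum_finset_product _ Finset.univ (fun c => Finset.univ.erase c)
      (by simp [eq_comm]),
    Finset.sum_finset_product_right _ Finset.univ (fun c => Finset.univ.erase c) (by simp)]
  have hA : ∑ c, ∑ a ∈ Finset.univ.erase c, (if c = j then discrDiv c a else 0)
      = ∑ k ∈ Finset.univ.erase j, discrDiv j k := by
    rw [Finset.sum_eq_single_of_mem j (Finset.mem_univ j) fun b _ hb =>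
      Finset.sum_eq_zero fun k _ => if_neg hb]
    simp
  have hB : ∑ c, ∑ a ∈ Finset.univ.erase c, (if c = j then discrDiv a c else 0)
      = -∑ k ∈ Finset.univ.erase j, discrDiv j k := by
    rw [Finset.sum_eq_single_of_mem j (Finset.mem_univ j) fun b _ hb =>
      Finset.sum_eq_zero fun k _ => if_neg hb, ← Finset.sum_neg_distrib]
    exact Finset.sum_congr rfl fun k hk => by
      rw [if_pos rfl, discrDiv_comm (Finset.ne_of_mem_erase hk).symm]
  rw [hA, hB]
  ring

/-- The quotient of `β` times the `β`-th power of `discr` by `x_j - x_k`. -/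
noncomputable def discrPowDiv (β : ℕ) (j k : Fin N) : Poly N :=
  (β : ℂ) • (discr N ^ (β - 1) * discrDiv j k)

theorem X_sub_X_mul_discrPowDiv (β : ℕ) {j k : Fin N} (h : j ≠ k) :
    (X j - X k) * discrPowDiv β j k = (β : ℂ) • discr N ^ β := by
  rw [discrPowDiv, mul_smul_comm, mul_left_comm, X_sub_X_mul_discrDiv h]
  -- For β = 0 the truncated power β - 1 does not matter, as both sides carry the factor β.
  rcases β with _ | n
  · simp
  · rw [Nat.add_sub_cancel, ← pow_succ]

theorem exch_discrPowDiv (β : ℕ) {j k : Fin N} (h : j ≠ k) :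
    exch j k (discrPowDiv β j k) = -discrPowDiv β j k := by
  apply mul_left_cancel₀ (X_sub_X_ne_zero h)
  have h1 := X_sub_X_mul_discrPowDiv β h
  have h2 := congrArg (exch j k) h1
  rw [exch_mul, map_sub, exch_X, exch_X, Equiv.swap_apply_left, Equiv.swap_apply_right, map_smul,
    exch_apply j k (discr N ^ β), map_pow, rename_discr] at h2
  linear_combination h1 - h2

theorem pderiv_discr_pow (β : ℕ) (j : Fin N) :
    pderiv j (discr N ^ β) = 2 * ∑ k ∈ Finset.univ.erase j, discrPowDiv β j k := by
  rw [pderiv_pow, pderiv_discr]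
  simp only [discrPowDiv, ← Finset.smul_sum, ← Finset.mul_sum]
  rw [← C_mul', map_natCast]
  ring

/-- Integration by parts for the Dunkl operators. -/
theorem gaussInt_dunkl (β : ℕ) (j : Fin N) (f g : Poly N) :
    gaussInt (dunkl β j f * g * discr N ^ β) + gaussInt (f * dunkl β j g * discr N ^ β)
      = 2 * gaussInt (X j * f * g * discr N ^ β) := by
  -- The divided differences together account for the derivative of the weight. Their cross terms
  -- with s_jk f and s_jk g cancel: exchanging x_j and x_k in the integral maps one to minus the
  -- other, because `discrPowDiv` is antisymmetric.
  have key : ∀ k ∈ Finset.univ.erase j,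
      gaussInt (((β : ℂ) • divDiff j k f) * g * discr N ^ β)
        + gaussInt (f * ((β : ℂ) • divDiff j k g) * discr N ^ β)
      = gaussInt (f * g * (2 * discrPowDiv β j k)) := by
    intro k hk
    have h := (Finset.ne_of_mem_erase hk).symm
    have hR := X_sub_X_mul_discrPowDiv β h
    have hf := X_sub_X_mul_divDiff h f
    have hg := X_sub_X_mul_divDiff h g
    have e1 : ((β : ℂ) • divDiff j k f) * g * discr N ^ β
        = f * g * discrPowDiv β j k - exch j k f * g * discrPowDiv β j k := by
      rw [smul_mul_assoc, smul_mul_assoc, ← mul_smul_comm, ← hR]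
      linear_combination g * discrPowDiv β j k * hf
    have e2 : f * ((β : ℂ) • divDiff j k g) * discr N ^ β
        = f * g * discrPowDiv β j k - f * exch j k g * discrPowDiv β j k := by
      rw [mul_smul_comm, smul_mul_assoc, ← mul_smul_comm, ← hR]
      linear_combination f * discrPowDiv β j k * hg
    have e3 : gaussInt (exch j k f * g * discrPowDiv β j k)
        = -gaussInt (f * exch j k g * discrPowDiv β j k) := by
      rw [← gaussInt_rename (Equiv.swap j k), ← exch_apply, exch_mul, exch_mul, exch_exch,
        exch_discrPowDiv β h, mul_neg, map_neg]
    rw [e1, e2, map_sub, map_sub, e3, show f * g * (2 * discrPowDiv β j k)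
      = f * g * discrPowDiv β j k + f * g * discrPowDiv β j k by ring, map_add]
    ring
  have h1 := gaussInt_pderiv j (f * g * discr N ^ β)
  have h2 : pderiv j (f * g * discr N ^ β) = pderiv j f * g * discr N ^ β
      + f * pderiv j g * discr N ^ β
      + ∑ k ∈ Finset.univ.erase j, f * g * (2 * discrPowDiv β j k) := by
    rw [pderiv_mul, pderiv_mul, pderiv_discr_pow, ← Finset.mul_sum, ← Finset.mul_sum]
    ring
  rw [h2, map_add, map_add, map_sum, ← Finset.sum_congr rfl key, Finset.sum_add_distrib] at h1
  rw [dunkl_apply, dunkl_apply, Finset.smul_sum, Finset.smul_sum]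
  simp only [add_mul, mul_add, Finset.sum_mul, Finset.mul_sum, map_add, map_sum]
  rw [show X j * f * g * discr N ^ β = X j * (f * g * discr N ^ β) by ring, ← h1]
  ring

/-! ### The pairing -/

/-- The sign relating `discr` and the square of the Vandermonde product. -/
def discrSign (N : ℕ) : ℂ := ∏ j : Fin N, ∏ _k ∈ Finset.Ioi j, (-1)

theorem discrSign_mul_self (N : ℕ) : discrSign N * discrSign N = 1 := by
  rw [discrSign, ← Finset.prod_mul_distrib]
  refine Finset.prod_eq_one fun j _ => ?_
  rw [← Finset.prod_mul_distrib]
  exact Finset.prod_eq_one fun k _ => by norm_num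

theorem eval_discr (x : Fin N → ℂ) :
    eval x (discr N) = discrSign N * (∏ j, ∏ k ∈ Finset.Ioi j, (x j - x k)) ^ 2 := by
  rw [discr, map_prod, ← Finset.prod_filter_mul_prod_filter_not _ (fun p => p.1 < p.2),
    Finset.prod_finset_product _ Finset.univ (fun c => Finset.Ioi c) (by
      rintro ⟨a, b⟩
      simp only [Finset.mem_filter, Finset.mem_offDiag, Finset.mem_univ, true_and, Finset.mem_Ioi]
      exact ⟨fun h => h.2, fun h => ⟨h.ne, h⟩⟩),
    Finset.prod_finset_product_right _ Finset.univ (fun c => Finset.Ioi c) (by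
      rintro ⟨a, b⟩
      simp only [Finset.mem_filter, Finset.mem_offDiag, Finset.mem_univ, true_and, Finset.mem_Ioi,
        not_lt]
      exact ⟨fun h => lt_of_le_of_ne h.2 (Ne.symm h.1), fun h => ⟨h.ne', h.le⟩⟩),
    discrSign, pow_two, ← Finset.prod_mul_distrib, ← Finset.prod_mul_distrib,
    ← Finset.prod_mul_distrib]
  refine Finset.prod_congr rfl fun j _ => ?_
  rw [← Finset.prod_mul_distrib, ← Finset.prod_mul_distrib, ← Finset.prod_mul_distrib]
  refine Finset.prod_congr rfl fun k _ => ?_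
  simp only [map_sub, eval_X]
  ring

theorem groundState_sq (β : ℕ) (x : Fin N → ℝ) : groundState β x ^ 2
    = ((∏ j, ∏ k ∈ Finset.Ioi j, (x j - x k)) ^ 2) ^ β * gaussWeight x := by
  rw [groundState, mul_pow]
  congr 1
  · simp only [Finset.prod_pow]
    rw [← pow_mul, mul_comm β 2, pow_mul]
    congr 1
    simp only [← Finset.prod_pow, sq_abs]
  · rw [gaussWeight, ← Finset.prod_pow]
    refine Finset.prod_congr rfl fun j _ => ?_
    rw [← Real.exp_nat_mul]
    congr 1
    push_cast
    ring

/-- Because β is an integer, the factor |x_j - x_k|^{2β} is polynomial, and its product over pairs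
is a power of `discr` up to sign. The pairing thus reduces to Gaussian integrals of polynomials. -/
theorem pairing_integrand (β : ℕ) (f g : Poly N) (x : Fin N → ℝ) :
    eval (fun i => (x i : ℂ)) f * eval (fun i => (x i : ℂ)) g * ((groundState β x ^ 2 : ℝ) : ℂ)
      = discrSign N ^ β * (eval (fun i => (x i : ℂ)) (f * g * discr N ^ β)
        * (gaussWeight x : ℂ)) := by
  have h : ((((∏ j, ∏ k ∈ Finset.Ioi j, (x j - x k)) ^ 2) ^ β : ℝ) : ℂ)
      = discrSign N ^ β * eval (fun i => (x i : ℂ)) (discr N) ^ β := by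
    rw [eval_discr, ← mul_pow, ← mul_assoc, discrSign_mul_self, one_mul]
    push_cast
    rfl
  rw [groundState_sq, Complex.ofReal_mul, h, map_mul, map_mul, map_pow]
  ring

theorem hermitePairing_eq (β : ℕ) (f g : Poly N) :
    hermitePairing β f g = discrSign N ^ β * gaussInt (f * g * discr N ^ β) := by
  rw [hermitePairing, gaussInt_apply, ← MeasureTheory.integral_const_mul]
  simp only [pairing_integrand]

theorem hermitePairing_comm (β : ℕ) (f g : Poly N) :
    hermitePairing β f g = hermitePairing β g f := by
  rw [hermitePairing_eq, hermitePairing_eq, mul_comm f g]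

/-- The pairing with a fixed polynomial, as a linear map. -/
noncomputable def pairingLeft (β : ℕ) (f : Poly N) : Poly N →ₗ[ℂ] ℂ :=
  discrSign N ^ β • gaussInt ∘ₗ LinearMap.mulRight ℂ (discr N ^ β) ∘ₗ LinearMap.mulLeft ℂ f

theorem pairingLeft_apply (β : ℕ) (f g : Poly N) :
    pairingLeft β f g = hermitePairing β f g := by
  simp [pairingLeft, hermitePairing_eq]

theorem hermitePairing_smul_right (β : ℕ) (c : ℂ) (f g : Poly N) :
    hermitePairing β f (c • g) = c * hermitePairing β f g := by
  rw [← pairingLeft_apply, map_smul, smul_eq_mul, pairingLeft_apply]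

theorem hermitePairing_smul_left (β : ℕ) (c : ℂ) (f g : Poly N) :
    hermitePairing β (c • f) g = c * hermitePairing β f g := by
  rw [hermitePairing_comm, hermitePairing_smul_right, hermitePairing_comm]

theorem hermitePairing_sum_right (β : ℕ) {ι : Type*} (s : Finset ι) (f : Poly N)
    (g : ι → Poly N) : hermitePairing β f (∑ i ∈ s, g i) = ∑ i ∈ s, hermitePairing β f (g i) := by
  simp only [← pairingLeft_apply, map_sum]

theorem hermitePairing_sum_left (β : ℕ) {ι : Type*} (s : Finset ι) (f : ι → Poly N)
    (g : Poly N) : hermitePairing β (∑ i ∈ s, f i) g = ∑ i ∈ s, hermitePairing β (f i) g := by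
  simp only [fun f => hermitePairing_comm β f g, hermitePairing_sum_right]

/-- By integration by parts the transpose of D_j is 2x_j - D_j, that is √2 ã†_j. -/
theorem hermitePairing_creation_left (β : ℕ) (j : Fin N) (f g : Poly N) :
    hermitePairing β (creation β j f) g = sqrtTwo⁻¹ * hermitePairing β f (dunkl β j g) := by
  have h := gaussInt_dunkl β j f g
  have e : ((2 : ℂ) • (X j * f) - dunkl β j f) * g * discr N ^ β
      = (2 : ℂ) • (X j * f * g * discr N ^ β) - dunkl β j f * g * discr N ^ β := by
    rw [sub_mul, sub_mul, smul_mul_assoc, smul_mul_assoc]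
  rw [creation_apply, hermitePairing_smul_left, hermitePairing_eq, hermitePairing_eq, e, map_sub,
    map_smul, smul_eq_mul, ← h, add_sub_cancel_left]

theorem hermitePairing_number (β : ℕ) (j : Fin N) (f g : Poly N) :
    hermitePairing β (number β j f) g = hermitePairing β f (number β j g) := by
  rw [number_apply, number_apply, hermitePairing_smul_left, hermitePairing_creation_left,
    hermitePairing_smul_right, hermitePairing_comm β f, hermitePairing_creation_left,
    hermitePairing_comm β (dunkl β j f)]

/-- Complex conjugation of the coefficients. -/
noncomputable def conj : Poly N →+* Poly N := map (starRingEnd ℂ)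

theorem eval_conj (f : Poly N) (x : Fin N → ℝ) : eval (fun i => (x i : ℂ)) (conj f)
    = starRingEnd ℂ (eval (fun i => (x i : ℂ)) f) := by
  induction f using MvPolynomial.induction_on with
  | C a => simp [conj]
  | add p q hp hq => simp only [map_add, hp, hq]
  | mul_X p i hp => simp only [map_mul, hp, eval_X]; simp [conj]

/-- The integrand is |f|² times the weight, continuous and nonnegative, so a vanishing integral
forces it to vanish at every real point. -/
theorem hermitePairing_conj_eq_zero {β : ℕ} {f : Poly N} (h : hermitePairing β f (conj f) = 0) :
    f = 0 := by
  set V : Poly N := ∏ j, ∏ k ∈ Finset.Ioi j, (X j - X k) with hV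
  have hV0 : V ≠ 0 := Finset.prod_ne_zero_iff.mpr fun j _ =>
    Finset.prod_ne_zero_iff.mpr fun k hk => X_sub_X_ne_zero (Finset.mem_Ioi.mp hk).ne
  set F : (Fin N → ℝ) → ℝ := fun x =>
    Complex.normSq (eval (fun i => (x i : ℂ)) f) * groundState β x ^ 2 with hF
  have hFc : ∀ x : Fin N → ℝ, eval (fun i => (x i : ℂ)) f * eval (fun i => (x i : ℂ)) (conj f)
      * ((groundState β x ^ 2 : ℝ) : ℂ) = (F x : ℂ) := fun x => by
    rw [eval_conj, Complex.mul_conj, hF, Complex.ofReal_mul]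
  have hint : MeasureTheory.Integrable F := by
    have h1 : MeasureTheory.Integrable fun x : Fin N → ℝ => (F x : ℂ) := by
      simp only [← hFc, pairing_integrand]
      exact (integrable_eval_mul_gaussWeight _).const_mul _
    simpa using h1.re
  have hcont : Continuous F := by
    have h1 : Continuous fun x : Fin N → ℝ => eval (fun i => (x i : ℂ)) f :=
      (MvPolynomial.continuous_eval f).comp (by fun_prop)
    have h2 : Continuous (groundState (N := N) β) := by
      unfold groundState
      fun_prop
    exact (Complex.continuous_normSq.comp h1).mul (h2.pow 2)
  have hzero : ∫ x, F x = 0 := by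
    rw [hermitePairing] at h
    simp only [hFc] at h
    rw [integral_complex_ofReal] at h
    exact_mod_cast h
  have hnn : 0 ≤ F := fun x => mul_nonneg (Complex.normSq_nonneg _) (sq_nonneg _)
  have hae := (MeasureTheory.integral_eq_zero_iff_of_nonneg hnn hint).mp hzero
  have hF0 : F = 0 := (Continuous.ae_eq_iff_eq _ hcont continuous_const).mp hae
  -- The weight vanishes on the hyperplanes x_j = x_k, so only f times the Vandermonde product is
  -- seen to vanish at all real points; `V` is then cancelled.
  have hfV : f * V = 0 := by
    refine funext_set (fun _ => Set.range (fun t : ℝ => (t : ℂ)))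
      (fun _ => Set.infinite_range_of_injective Complex.ofReal_injective) fun y hy => ?_
    choose x hx using fun i => hy i (Set.mem_univ i)
    obtain rfl : (fun i => (x i : ℂ)) = y := funext hx
    have h1 : F x = 0 := congrFun hF0 x
    rw [hF] at h1
    simp only [mul_eq_zero, Complex.normSq_eq_zero] at h1
    rw [map_mul, map_zero, mul_eq_zero]
    refine h1.imp id fun h2 => ?_
    rw [groundState_sq, mul_eq_zero] at h2
    have h3 : (∏ j, ∏ k ∈ Finset.Ioi j, (x j - x k)) = 0 := by
      rcases h2 with h2 | h2
      · by_contra h3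
        exact pow_ne_zero _ (pow_ne_zero _ h3) h2
      · exact absurd h2 (Finset.prod_pos fun j _ => Real.exp_pos _).ne'
    rw [hV]
    simp only [map_prod, map_sub, eval_X]
    exact_mod_cast congrArg Complex.ofReal h3
  exact (mul_eq_zero.mp hfV).resolve_right hV0

theorem conj_mono (lam : Fin N → ℕ) : conj (mono lam) = mono lam := by
  ext ν
  rw [conj, coeff_map, coeff_mono]
  split_ifs <;> simp

theorem conj_mem_span_mono {S : Set (Fin N → ℕ)} {f : Poly N}
    (hf : f ∈ Submodule.span ℂ {p : Poly N | ∃ mu, Antitone mu ∧ mu ∈ S ∧ p = mono mu}) :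
    conj f ∈ Submodule.span ℂ {p : Poly N | ∃ mu, Antitone mu ∧ mu ∈ S ∧ p = mono mu} := by
  induction hf using Submodule.span_induction with
  | mem p hp =>
    obtain ⟨mu, h1, h2, rfl⟩ := hp
    rw [conj_mono]
    exact Submodule.subset_span ⟨mu, h1, h2, rfl⟩
  | zero => rw [map_zero]; exact zero_mem _
  | add p q _ _ hp hq => rw [map_add]; exact add_mem hp hq
  | smul c p _ hp =>
    have : conj (c • p) = starRingEnd ℂ c • conj p := by
      rw [conj, smul_eq_C_mul, map_mul, map_C, smul_eq_C_mul]
    rw [this]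
    exact Submodule.smul_mem _ _ hp

/-- The pairing is nondegenerate on spans of monomial symmetric functions. -/
theorem eq_zero_of_mem_span_mono {β : ℕ} {S : Set (Fin N → ℕ)} {f : Poly N}
    (hf : f ∈ Submodule.span ℂ {p : Poly N | ∃ mu, Antitone mu ∧ mu ∈ S ∧ p = mono mu})
    (h : ∀ mu : Fin N → ℕ, Antitone mu → mu ∈ S → hermitePairing β f (mono mu) = 0) : f = 0 := by
  refine hermitePairing_conj_eq_zero (β := β) ?_
  have h1 : Submodule.span ℂ {p : Poly N | ∃ mu, Antitone mu ∧ mu ∈ S ∧ p = mono mu}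
      ≤ LinearMap.ker (pairingLeft β f) := by
    rw [Submodule.span_le]
    rintro _ ⟨mu, h1, h2, rfl⟩
    rw [SetLike.mem_coe, LinearMap.mem_ker, pairingLeft_apply, h mu h1 h2]
  -- The m_μ have real coefficients, so the span contains the conjugate of f, and f is orthogonal to
  -- it.
  have h2 := h1 (conj_mem_span_mono hf)
  rwa [LinearMap.mem_ker, pairingLeft_apply] at h2

/-! ### Triangular polynomials -/

theorem IsMonicTriangular.mem {R : (Fin N → ℕ) → (Fin N → ℕ) → Prop} {lam : Fin N → ℕ}
    {P : Poly N} (h : IsMonicTriangular R lam P) (S : Submodule ℂ (Poly N))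
    (h0 : mono lam ∈ S) (hS : ∀ mu, Antitone mu → R mu lam → mono mu ∈ S) : P ∈ S := by
  have h1 : P - mono lam ∈ S := by
    refine Submodule.span_le.mpr ?_ h
    rintro _ ⟨mu, hmu, hR, rfl⟩
    exact hS mu hmu hR
  have h2 := S.add_mem h1 h0
  rwa [sub_add_cancel] at h2

theorem IsMonicTriangular.isSymmetric {R : (Fin N → ℕ) → (Fin N → ℕ) → Prop} {lam : Fin N → ℕ}
    {P : Poly N} (h : IsMonicTriangular R lam P) : P.IsSymmetric :=
  h.mem (symmetricSubalgebra (Fin N) ℂ).toSubmodule (isSymmetric_mono lam)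
    fun mu _ _ => isSymmetric_mono mu

theorem IsMonicTriangular.mem_domSubmodule {R : (Fin N → ℕ) → (Fin N → ℕ) → Prop}
    (hR : ∀ {a b}, R a b → DomLT a b) {lam : Fin N → ℕ} (hlam : Antitone lam)
    {P : Poly N} (h : IsMonicTriangular R lam P) : P ∈ domSubmodule lam :=
  h.mem _ (mono_mem_domSubmodule hlam fun _ => le_rfl)
    fun _ hmu hlt => mono_mem_domSubmodule hmu (hR hlt).2

theorem IsMonicTriangular.isHomogeneous {lam : Fin N → ℕ} (hlam : Antitone lam) {P : Poly N}
    (h : IsMonicTriangular DomLTSame lam P) : P.IsHomogeneous (wt lam) :=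
  h.mem (homogeneousSubmodule (Fin N) ℂ (wt lam)) (isHomogeneous_mono hlam)
    fun _ hmu hlt => hlt.1 ▸ isHomogeneous_mono hmu

theorem coeff_mono_of_ne {mu lam : Fin N → ℕ} (hmu : Antitone mu) (hlam : Antitone lam)
    (h : mu ≠ lam) : coeff (expo lam) (mono mu) = 0 := by
  rw [coeff_mono, if_neg]
  exact fun he => h (eq_of_antitone_of_map_eq hlam hmu he).symm

theorem IsMonicTriangular.coeff_eq_one {R : (Fin N → ℕ) → (Fin N → ℕ) → Prop}
    (hR : ∀ {a b}, R a b → DomLT a b) {lam : Fin N → ℕ} (hlam : Antitone lam)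
    {P : Poly N} (h : IsMonicTriangular R lam P) : coeff (expo lam) P = 1 := by
  have h1 : P - mono lam ∈ LinearMap.ker (lcoeff ℂ (expo lam)) := by
    refine Submodule.span_le.mpr ?_ h
    rintro _ ⟨mu, hmu, hlt, rfl⟩
    exact coeff_mono_of_ne hmu hlam (hR hlt).1
  rw [LinearMap.mem_ker, map_sub, sub_eq_zero] at h1
  exact h1.trans (coeff_mono_self lam)

theorem mem_span_domLTSame {lam : Fin N → ℕ} {f : Poly N} (hs : f.IsSymmetric)
    (hd : f ∈ domSubmodule lam) (hh : f.IsHomogeneous (wt lam)) (hc : coeff (expo lam) f = 0) :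
    f ∈ Submodule.span ℂ {p : Poly N | ∃ mu, Antitone mu ∧ DomLTSame mu lam ∧ p = mono mu} :=
  mem_span_mono_of_isSymmetric (S := {mu | DomLTSame mu lam}) hs fun _ _ hmem =>
    ⟨isHomogeneous_iff.mp hh _ hmem, fun he => mem_support_iff.mp hmem (he ▸ hc),
      domLE_of_dom (hd hmem)⟩

theorem mem_span_domLT_of_sum_lt {lam : Fin N → ℕ} {f : Poly N} (hs : f.IsSymmetric)
    (hd : f ∈ domSubmodule lam) (hh : ∀ κ ∈ f.support, ∑ i, κ i < wt lam) :
    f ∈ Submodule.span ℂ {p : Poly N | ∃ mu, Antitone mu ∧ DomLT mu lam ∧ p = mono mu} :=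
  mem_span_mono_of_isSymmetric (S := {mu | DomLT mu lam}) hs fun _ _ hmem =>
    ⟨fun he => (hh _ hmem).ne (he ▸ rfl), domLE_of_dom (hd hmem)⟩

theorem isSymmetric_calogero {β : ℕ} {f : Poly N} (hf : f.IsSymmetric) :
    (calogero β f).IsSymmetric := fun π => by
  rw [rename_calogero, hf π]

theorem isSymmetric_sigmaA {β : ℕ} {f : Poly N} (hf : f.IsSymmetric) :
    (sigmaA β f).IsSymmetric := fun π => by
  rw [rename_sigmaA, hf π]

/-! ### Jack polynomials -/

/-- The eigenvalue is forced by comparing coefficients of x^λ, where J has coefficient 1. -/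
theorem IsJack.calogero_eq {β : ℕ} {lam : Fin N → ℕ} (hlam : Antitone lam) {J : Poly N}
    (h : IsJack β lam J) : calogero β J = (energy β lam : ℂ) • J := by
  obtain ⟨ht, E, hE⟩ := h
  obtain ⟨c, hc⟩ := sutherland_of_isSymmetric N β
  have h1 : calogero β J = (E - c) • J := by
    rw [sub_smul, ← hE, hc J ht.isSymmetric, add_sub_cancel_right]
  have h2 := coeff_calogero (β := β) ht.isSymmetric (ht.mem_domSubmodule (fun h => h.2) hlam)
  rw [h1, coeff_smul, ht.coeff_eq_one (fun h => h.2) hlam, smul_eq_mul, mul_one, mul_one] at h2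
  rw [h1, h2]

theorem isJack_of_calogero_eq {β : ℕ} {lam : Fin N → ℕ} {J : Poly N}
    (ht : IsMonicTriangular DomLTSame lam J) {e : ℂ} (h : calogero β J = e • J) :
    IsJack β lam J := by
  obtain ⟨c, hc⟩ := sutherland_of_isSymmetric N β
  exact ⟨ht, e + c, by rw [hc J ht.isSymmetric, h, add_smul]⟩

/-- Let T = ∑ (x_j D_j)² - `energy β lam`. By strict monotonicity of the energy, T is invertible on
each smaller Jack polynomial, hence maps the span V of the smaller m_μ onto a space containing V. As
T m_λ lies in V, some w in V has T w = T m_λ, and m_λ - w is the Jack polynomial. -/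
theorem exists_isJack (β : ℕ) {lam : Fin N → ℕ} (hlam : Antitone lam) : ∃ J, IsJack β lam J := by
  induction hn : height lam using Nat.strong_induction_on generalizing lam with
  | _ n ih =>
    subst hn
    set V : Submodule ℂ (Poly N) :=
      Submodule.span ℂ {p : Poly N | ∃ mu, Antitone mu ∧ DomLTSame mu lam ∧ p = mono mu} with hV
    set T : Module.End ℂ (Poly N) := calogero β - (energy β lam : ℂ) • 1 with hT
    have hTa : ∀ f, T f = calogero β f - (energy β lam : ℂ) • f := fun f => by simp [hT]
    have hex : ∀ mu : Fin N → ℕ, ∃ q : Poly N, Antitone mu → DomLTSame mu lam →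
        IsJack β mu q := fun mu => by
      by_cases h : Antitone mu ∧ DomLTSame mu lam
      · obtain ⟨q, hq⟩ := ih _ (height_lt_of_domLT h.2.2) h.1 rfl
        exact ⟨q, fun _ _ => hq⟩
      · exact ⟨0, fun h1 h2 => absurd ⟨h1, h2⟩ h⟩
    choose q hq using hex
    have hVmono : ∀ {mu}, Antitone mu → DomLTSame mu lam → mono mu ∈ V :=
      fun h1 h2 => Submodule.subset_span ⟨_, h1, h2, rfl⟩
    -- Smaller Jack polynomials span the smaller m_μ by triangularity, and each is T of a multiple
    -- of itself.
    have hle : V ≤ V.map T := by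
      refine Submodule.span_le.mpr ?_
      rintro _ ⟨mu, hmu, hlt, rfl⟩
      have hsub : ∀ {nu}, nu = mu ∨ DomLTSame nu mu → DomLTSame nu lam := by
        rintro nu (rfl | h)
        · exact hlt
        · exact h.trans hlt
      refine Submodule.span_le.mpr ?_ (mono_mem_span_of_triangular (R := DomLTSame) (fun h => h.2)
        (fun h h' => h.trans h') (q := q) hmu fun nu hnu h => (hq nu hnu (hsub h)).1)
      rintro _ ⟨nu, hnu, h, rfl⟩
      have hJ := hq nu hnu (hsub h)
      have hne : ((energy β nu : ℂ) - energy β lam) ≠ 0 := by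
        rw [sub_ne_zero]
        exact_mod_cast (energy_lt_energy hnu (hsub h)).ne
      refine ⟨((energy β nu : ℂ) - energy β lam)⁻¹ • q nu, V.smul_mem _ ?_, ?_⟩
      · exact hJ.1.mem V (hVmono hnu (hsub h)) fun ξ hξ h' => hVmono hξ (h'.trans (hsub h))
      · rw [map_smul, hTa, hJ.calogero_eq hnu, ← sub_smul, smul_smul, inv_mul_cancel₀ hne, one_smul]
    have hdom : mono lam ∈ domSubmodule lam := mono_mem_domSubmodule hlam fun _ => le_rfl
    have hmem : T (mono lam) ∈ V := by
      rw [hTa]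
      refine mem_span_domLTSame ?_ ?_ ?_ ?_
      · exact (symmetricSubalgebra (Fin N) ℂ).toSubmodule.sub_mem
          (isSymmetric_calogero (isSymmetric_mono lam))
          (Submodule.smul_mem _ _ (isSymmetric_mono lam))
      · exact sub_mem (calogero_mem_domSubmodule hdom) (Submodule.smul_mem _ _ hdom)
      · exact (homogeneousSubmodule (Fin N) ℂ (wt lam)).sub_mem
          (isHomogeneous_calogero (isHomogeneous_mono hlam))
          (Submodule.smul_mem _ _ (isHomogeneous_mono hlam))
      · rw [coeff_sub, coeff_calogero (isSymmetric_mono lam) hdom, coeff_smul, smul_eq_mul,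
          sub_self]
    obtain ⟨w, hw, hTw⟩ := hle hmem
    refine ⟨mono lam - w, isJack_of_calogero_eq (e := energy β lam) ?_ ?_⟩
    · rw [IsMonicTriangular, sub_sub_cancel_left]
      exact V.neg_mem hw
    · have h1 : T (mono lam - w) = 0 := by rw [map_sub, hTw, sub_self]
      rwa [hTa, sub_eq_zero] at h1

/-! ### Hermite polynomials -/

/-- The image of a polynomial under the intertwiner, normalized for the degree of `lam`. -/
noncomputable def hermiteOf (β : ℕ) (lam : Fin N → ℕ) (J : Poly N) : Poly N :=
  (sqrtTwo ^ wt lam)⁻¹ • sigmaA β J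

theorem inv_sqrtTwo_pow (d : ℕ) :
    (sqrtTwo ^ d)⁻¹ = (((2 : ℝ) ^ (-(d : ℝ) / 2) : ℝ) : ℂ) := by
  rw [sqrtTwo, ← Complex.ofReal_pow, ← Complex.ofReal_inv, Real.sqrt_eq_rpow, ← Real.rpow_natCast,
    ← Real.rpow_mul (by norm_num), ← Real.rpow_neg (by norm_num)]
  congr 2
  ring

theorem IsJack.isMonicTriangular_hermiteOf {β : ℕ} {lam : Fin N → ℕ} (hlam : Antitone lam)
    {J : Poly N} (h : IsJack β lam J) : IsMonicTriangular DomLT lam (hermiteOf β lam J) := by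
  have hd := h.1.mem_domSubmodule (fun h => h.2) hlam
  obtain ⟨h1, h2⟩ := sigmaA_sub_mem (β := β) (h.1.isHomogeneous hlam) hd
  have hs : (hermiteOf β lam J - J).IsSymmetric :=
    (symmetricSubalgebra (Fin N) ℂ).toSubmodule.sub_mem
      (Submodule.smul_mem _ _ (isSymmetric_sigmaA h.1.isSymmetric)) h.1.isSymmetric
  have h3 := mem_span_domLT_of_sum_lt hs h1 h2
  have h4 : J - mono lam
      ∈ Submodule.span ℂ {p : Poly N | ∃ mu, Antitone mu ∧ DomLT mu lam ∧ p = mono mu} := by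
    refine Submodule.span_mono ?_ h.1
    rintro _ ⟨mu, hmu, hlt, rfl⟩
    exact ⟨mu, hmu, hlt.2, rfl⟩
  have h5 := add_mem h3 h4
  rwa [sub_add_sub_cancel] at h5

theorem eq_zero_of_selfAdjoint {β : ℕ} {T : Module.End ℂ (Poly N)}
    (hT : ∀ f g, hermitePairing β (T f) g = hermitePairing β f (T g)) {f g : Poly N} {a b : ℂ}
    (hf : T f = a • f) (hg : T g = b • g) (hab : a ≠ b) : hermitePairing β f g = 0 := by
  have h := hT f g
  rw [hf, hg, hermitePairing_smul_left, hermitePairing_smul_right] at h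
  have h' : (a - b) * hermitePairing β f g = 0 := by rw [sub_mul, h, sub_self]
  exact (mul_eq_zero.mp h').resolve_left (sub_ne_zero.mpr hab)

theorem sum_number_sigmaA_of_isHomogeneous {β d : ℕ} {f : Poly N} (hs : f.IsSymmetric)
    (hf : f.IsHomogeneous d) : (∑ j, number β j) (sigmaA β f) = (d : ℂ) • sigmaA β f := by
  rw [LinearMap.sum_apply]
  simp only [number_sigmaA, xD_apply, dunkl_of_isSymmetric β hs]
  rw [← map_sum, hf.sum_X_mul_pderiv, ← Nat.cast_smul_eq_nsmul ℂ, map_smul]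

/-- The total number operator separates different weights; within one weight the energies are
distinct on comparable partitions, so ∑ (ã†_j ã_j)² separates them. -/
theorem hermitePairing_sigmaA_eq_zero {β : ℕ} {lam mu : Fin N → ℕ} (hlam : Antitone lam)
    (hmu : Antitone mu) (hlt : DomLT mu lam) {J K : Poly N} (hJ : IsJack β lam J)
    (hK : IsJack β mu K) : hermitePairing β (sigmaA β J) (sigmaA β K) = 0 := by
  by_cases hw : wt mu = wt lam
  · refine eq_zero_of_selfAdjoint (T := ∑ j, number β j * number β j)
      (a := energy β lam) (b := energy β mu) ?_ ?_ ?_ ?_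
    · intro f g
      simp only [LinearMap.sum_apply, hermitePairing_sum_left, hermitePairing_sum_right,
        Module.End.mul_apply, hermitePairing_number]
    · simp only [LinearMap.sum_apply, Module.End.mul_apply]
      rw [sum_number_sigmaA, hJ.calogero_eq hlam, map_smul]
    · simp only [LinearMap.sum_apply, Module.End.mul_apply]
      rw [sum_number_sigmaA, hK.calogero_eq hmu, map_smul]
    · exact_mod_cast (energy_lt_energy hmu ⟨hw, hlt⟩).ne'
  · refine eq_zero_of_selfAdjoint (T := ∑ j, number β j) ?_
      (sum_number_sigmaA_of_isHomogeneous hJ.1.isSymmetric (hJ.1.isHomogeneous hlam))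
      (sum_number_sigmaA_of_isHomogeneous hK.1.isSymmetric (hK.1.isHomogeneous hmu)) ?_
    · intro f g
      simp only [LinearMap.sum_apply, hermitePairing_sum_left, hermitePairing_sum_right,
        hermitePairing_number]
    · exact_mod_cast Ne.symm hw

/-- Orthogonality is known only against images of Jack polynomials; triangularity expands m_μ in
those with index at most μ, all strictly below λ by transitivity. -/
theorem IsJack.isHermite_hermiteOf {β : ℕ} {lam : Fin N → ℕ} (hlam : Antitone lam)
    {J : Poly N} (h : IsJack β lam J) : IsHermite β lam (hermiteOf β lam J) := by
  refine ⟨h.isMonicTriangular_hermiteOf hlam, fun mu hmu hlt => ?_⟩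
  have hex : ∀ nu : Fin N → ℕ, ∃ K : Poly N, Antitone nu → IsJack β nu K := fun nu => by
    by_cases hnu : Antitone nu
    · obtain ⟨K, hK⟩ := exists_isJack β hnu
      exact ⟨K, fun _ => hK⟩
    · exact ⟨0, fun h => absurd h hnu⟩
  choose K hK using hex
  have hspan := mono_mem_span_of_triangular (R := DomLT) (fun h => h) (fun h h' => h.trans h')
    (q := fun nu => hermiteOf β nu (K nu)) hmu
    fun nu hnu _ => (hK nu hnu).isMonicTriangular_hermiteOf hnu
  have hker : mono mu ∈ LinearMap.ker (pairingLeft β (hermiteOf β lam J)) := by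
    refine Submodule.span_le.mpr ?_ hspan
    rintro _ ⟨nu, hnu, hle, rfl⟩
    have hlt' : DomLT nu lam := by
      rcases hle with rfl | h'
      · exact hlt
      · exact h'.trans hlt
    rw [SetLike.mem_coe, LinearMap.mem_ker, pairingLeft_apply, hermiteOf, hermiteOf,
      hermitePairing_smul_left, hermitePairing_smul_right,
      hermitePairing_sigmaA_eq_zero hlam hnu hlt' h (hK nu hnu), mul_zero, mul_zero]
  rwa [LinearMap.mem_ker, pairingLeft_apply] at hker

theorem IsHermite.unique {β : ℕ} {lam : Fin N → ℕ} {H H' : Poly N} (h : IsHermite β lam H)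
    (h' : IsHermite β lam H') : H = H' := by
  rw [← sub_eq_zero]
  have h1 := sub_mem h.1 h'.1
  rw [sub_sub_sub_cancel_right] at h1
  refine eq_zero_of_mem_span_mono (β := β) (S := {mu | DomLT mu lam}) h1 fun mu hmu hlt => ?_
  rw [hermitePairing_comm, ← pairingLeft_apply, map_sub, pairingLeft_apply, pairingLeft_apply,
    hermitePairing_comm, h.2 mu hmu hlt, hermitePairing_comm, h'.2 mu hmu hlt, sub_zero]

/-- Two candidates have the same image under σ. Their difference is homogeneous, and σ preserves its
top-degree part up to a nonzero scalar, so it vanishes. -/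
theorem IsJack.unique {β : ℕ} {lam : Fin N → ℕ} (hlam : Antitone lam) {J J' : Poly N}
    (h : IsJack β lam J) (h' : IsJack β lam J') : J = J' := by
  have h1 := (h.isHermite_hermiteOf hlam).unique (h'.isHermite_hermiteOf hlam)
  have h2 : (sqrtTwo ^ wt lam)⁻¹ • sigmaA β (J - J') = 0 := by
    rw [map_sub, smul_sub, sub_eq_zero]
    exact h1
  have hhom : (J - J').IsHomogeneous (wt lam) :=
    (homogeneousSubmodule (Fin N) ℂ (wt lam)).sub_mem (h.1.isHomogeneous hlam)
      (h'.1.isHomogeneous hlam)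
  have h3 := (sigmaA_sub_mem (β := β) hhom (sub_mem (h.1.mem_domSubmodule (fun h => h.2) hlam)
    (h'.1.mem_domSubmodule (fun h => h.2) hlam))).2
  rw [h2, zero_sub, support_neg] at h3
  rw [← sub_eq_zero, ← support_eq_empty, Finset.eq_empty_iff_forall_notMem]
  exact fun κ hκ => (h3 κ hκ).ne (isHomogeneous_iff.mp hhom κ hκ)

end CalogeroHermite

theorem mainTheorem3 (N β : ℕ) (lam : Fin N → ℕ) (hlam : Antitone lam) :
    (∀ i j : Fin N, Commute (CalogeroHermite.creation β i) (CalogeroHermite.creation β j)) ∧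
    (∃! J : CalogeroHermite.Poly N, CalogeroHermite.IsJack β lam J) ∧
    (∃! H : CalogeroHermite.Poly N, CalogeroHermite.IsHermite β lam H) ∧
    ∀ J H : CalogeroHermite.Poly N,
      CalogeroHermite.IsJack β lam J → CalogeroHermite.IsHermite β lam H →
        H = (((2 : ℝ) ^ (-(CalogeroHermite.wt lam : ℝ) / 2) : ℝ) : ℂ)
              • CalogeroHermite.sigmaA β J ∧
        (((2 : ℝ) ^ (-(CalogeroHermite.wt lam : ℝ) / 2) : ℝ) : ℂ)
              • CalogeroHermite.sigmaA β J
          = (((2 : ℝ) ^ (-(CalogeroHermite.wt lam : ℝ) / 2) : ℝ) : ℂ)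
              • CalogeroHermite.opEval (CalogeroHermite.creation β) J 1 := by
  have key := fun (J : CalogeroHermite.Poly N) (hJ : CalogeroHermite.IsJack β lam J) =>
    hJ.isHermite_hermiteOf hlam
  obtain ⟨J, hJ⟩ := CalogeroHermite.exists_isJack β hlam
  refine ⟨CalogeroHermite.commute_creation β, ⟨J, hJ, fun J' hJ' => hJ'.unique hlam hJ⟩,
    ⟨_, key J hJ, fun H hH => hH.unique (key J hJ)⟩, fun J H hJ hH => ⟨?_, rfl⟩⟩
  rw [hH.unique (key J hJ), CalogeroHermite.hermiteOf, CalogeroHermite.inv_sqrtTwo_pow]
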